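/- Let $\mathbb X$ be a Polish space with a metric generating its topology, $\eta$ a probability measure on $\mathbb X$ without atoms, and $(\rho_x)_{x\in\mathbb X}$ a measurable ($s$-finite) kernel of measures on $\mathbb R^+=(0,\infty)$ such that $\nu(dx,ds)=\eta(dx)\rho_x(ds)$ satisfies $\int_{A\times\mathbb R^+}\min(s,t)\,\nu(dx,ds)<\infty$ for all bounded Borel $A\subset\mathbb X$ and $t>0$. Call $\widetilde\mu(A)=\int_{A\times\mathbb R^+}s\,N(dx,ds)$, with $N$ a Poisson process of intensity $\nu$, the completely random measure (CRM) with intensity $\nu$, and assume $0<\widetilde\mu(\mathbb X)<\infty$ almost surely. Let $\gamma,q\ge 0$, $h(x)=e^{-\gamma x}x^{-q}$, and assume $E[h(\widetilde\mu(\mathbb X))]<\infty$. Let $\widetilde\mu_t$ be a random measure whose law is the tilted law $h(\mu(\mathbb X))\,\mathcal P_{\widetilde\mu}(d\mu)/E[h(\widetilde\mu(\mathbb X))]$, and $\widetilde G_t=\widetilde\mu_t/\widetilde\mu_t(\mathbb X)$. Let $n\ge1$; given $\widetilde\mu_t$, let $\mathbf X_n=(X_1,\dots,X_n)$ be i.i.d.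 from $\widetilde G_t$; given $(\widetilde\mu_t,\mathbf X_n)$, let $U_n$ have the gamma distribution with shape $n+q$ and rate $\widetilde\mu_t(\mathbb X)$. Let $Y_1,\dots,Y_K$ be the distinct values of $\mathbf X_n$ and $n_k=\#\{i: X_i=Y_k\}$. Put $$\psi_0(b)=\int_{\mathbb X}\int_{\mathbb R^+}(1-e^{-bs})\,\rho_x(ds)\,\eta(dx),\qquad \tau_{m,z}(a)=\int_{\mathbb R^+}s^m e^{-sa}\,\rho_z(ds).$$ Then $\psi_0(b)<\infty$ for all $b>0$, and the following hold. (i) For almost every value of $(U_n,\mathbf X_n)$, $0<\tau_{n_k,Y_k}(\gamma+U_n)<\infty$ for every $k$, and the conditional law of $\widetilde\mu_t$ given $(U_n,\mathbf X_n)$ is the law of $$\widetilde\mu^{(U_n,\mathbf X_n)}=\widetilde\mu^{(U_n)}+\sum_{k=1}^{K}J_k\,\delta_{Y_k},$$ where (conditionally on $(U_n,\mathbf X_n)$) $\widetilde\mu^{(U_n)}$ is a CRM with intensity $\eta(dx)\,e^{-s(\gamma+U_n)}\rho_x(ds)$, each $J_k$ has law $s^{n_k}e^{-s(\gamma+U_n)}\rho_{Y_k}(ds)/\tau_{n_k,Y_k}(\gamma+U_n)$,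 and $\widetilde\mu^{(U_n)},J_1,\dots,J_K$ are mutually independent. This random measure $\widetilde\mu^{(U_n,\mathbf X_n)}$ is completely random: it is boundedly finite and its values on finitely many pairwise disjoint bounded Borel sets are independent. Moreover $0<\widetilde\mu^{(U_n,\mathbf X_n)}(\mathbb X)<\infty$ almost surely, and the conditional law of $\widetilde G_t$ given $(U_n,\mathbf X_n)$ is the law of $\widetilde\mu^{(U_n,\mathbf X_n)}/\widetilde\mu^{(U_n,\mathbf X_n)}(\mathbb X)$. (ii) For almost every value of $\mathbf X_n$, the conditional law of $U_n$ given $\mathbf X_n$ has on $(0,\infty)$ the density $$f_{U_n\mid\mathbf X_n}(u)=\frac{e^{-\psi_0(\gamma+u)}\prod_{k=1}^{K}\tau_{n_k,Y_k}(\gamma+u)\,u^{n+q-1}}{\int_0^\infty e^{-\psi_0(\gamma+v)}\prod_{k=1}^{K}\tau_{n_k,Y_k}(\gamma+v)\,v^{n+q-1}\,dv},$$ the denominator being positive and finite. -/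

import Mathlib

open MeasureTheory ProbabilityTheory Set
open scoped ENNReal

namespace TiltedCRM

noncomputable section

/-- `Q`, a law on measures on `Z`, is the law of a Poisson process (Poisson random measure) with
intensity `ν`: the masses of sets of finite intensity are Poisson distributed, and the masses of
finitely many pairwise disjoint such sets are independent. -/
structure IsPoissonLaw {Z : Type*} [MeasurableSpace Z] (Q : Measure (Measure Z))
    (ν : Measure Z) : Prop where
  isProbabilityMeasure : IsProbabilityMeasure Q
  poisson : ∀ B : Set Z, MeasurableSet B → ν B < ∞ →
    Q.map (fun N => N B) = (poissonMeasure (ν B).toNNReal).map (fun k : ℕ => (k : ℝ≥0∞))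
  indep : ∀ (k : ℕ) (B : Fin k → Set Z), (∀ i, MeasurableSet (B i)) → (∀ i, ν (B i) < ∞) →
    Pairwise (fun i j => Disjoint (B i) (B j)) → iIndepFun (fun i N => N (B i)) Q

/-- The random measure `A ↦ ∫_{A × ℝ⁺} s N(dx, ds)` attached to a configuration `N`. -/
def jumpSum {X : Type*} [MeasurableSpace X] (N : Measure (X × ℝ)) : Measure X :=
  (N.withDensity (fun p => ENNReal.ofReal p.2)).map Prod.fst

/-- `L` is the law of the completely random measure `∫ s N(·, ds)`, `N` a Poisson process with
intensity `ν` on `X × ℝ⁺`. -/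
def IsCRMLaw {X : Type*} [MeasurableSpace X] (L : Measure (Measure X))
    (ν : Measure (X × ℝ)) : Prop :=
  ∃ Q : Measure (Measure (X × ℝ)), IsPoissonLaw Q ν ∧ L = Q.map jumpSum

/-- `L` is the law of a completely random measure in the general sense: a random boundedly finite
measure whose values on finitely many pairwise disjoint bounded Borel sets are independent. -/
structure IsCompletelyRandom {X : Type*} [MeasurableSpace X] [PseudoMetricSpace X]
    (L : Measure (Measure X)) : Prop where
  isProbabilityMeasure : IsProbabilityMeasure L
  boundedlyFinite : ∀ᵐ m ∂L, ∀ A : Set X, MeasurableSet A → Bornology.IsBounded A → m A < ∞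
  indep : ∀ (k : ℕ) (A : Fin k → Set X), (∀ i, MeasurableSet (A i)) →
    (∀ i, Bornology.IsBounded (A i)) →
    Pairwise (fun i j => Disjoint (A i) (A j)) → iIndepFun (fun i m => m (A i)) L

/-- The normalization `m / m(X)` of a measure (meaningful when `0 < m(X) < ∞`). -/
def normalizeMeasure {X : Type*} [MeasurableSpace X] (m : Measure X) : Measure X :=
  (m univ)⁻¹ • m

/-- The normalizing constant `E[h(μ(X))]` of the tilted law. -/
def tiltConst {X : Type*} [MeasurableSpace X] (h : ℝ → ℝ) (L : Measure (Measure X)) : ℝ≥0∞ :=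
  ∫⁻ m, ENNReal.ofReal (h (m univ).toReal) ∂L

/-- The tilted law `h(μ(X)) L(dμ) / E[h(μ(X))]`. -/
def tiltedLaw {X : Type*} [MeasurableSpace X] (h : ℝ → ℝ) (L : Measure (Measure X)) :
    Measure (Measure X) :=
  (tiltConst h L)⁻¹ • L.withDensity (fun m => ENNReal.ofReal (h (m univ).toReal))

/-- The polynomial-exponential tilt `h(x) = e^{-γ x} x^{-q}`. -/
def petTilt (γ q x : ℝ) : ℝ := Real.exp (-(γ * x)) * x ^ (-q)

/-- `(μt, S, U)` is an augmented sample of size `n` from a prior `M` on measures: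
`μt` has law `M`; given `μt`, the data `S 0, …, S (n-1)` are i.i.d. from `μt / μt(X)`;
given `(μt, S)`, the variable `U` has the gamma law with shape `n + q` and rate `μt(X)`. -/
structure IsAugmentedSample {Ω X : Type*} [MeasurableSpace Ω] [MeasurableSpace X]
    (M : Measure (Measure X)) (q : ℝ) {n : ℕ} (P : Measure Ω)
    (μt : Ω → Measure X) (S : Ω → Fin n → X) (U : Ω → ℝ) : Prop where
  measurable_measure : Measurable μt
  measurable_data : Measurable S
  measurable_aux : Measurable U
  prior : P.map μt = M
  likelihood : ∀ (A : Set (Measure X)) (B : Fin n → Set X), MeasurableSet A →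
    (∀ i, MeasurableSet (B i)) →
    P {ω | μt ω ∈ A ∧ ∀ i, S ω i ∈ B i} = ∫⁻ m in A, ∏ i, normalizeMeasure m (B i) ∂M
  augmentation : ∀ (C : Set (Measure X × (Fin n → X))) (D : Set ℝ), MeasurableSet C →
    MeasurableSet D →
    P {ω | (μt ω, S ω) ∈ C ∧ U ω ∈ D} =
      ∫⁻ ω in {ω | (μt ω, S ω) ∈ C}, gammaMeasure (n + q) (μt ω univ).toReal D ∂P

open scoped Classical in
/-- The set `{Y_1, …, Y_K}` of distinct values of the data `x`. -/
def distinctValues {X : Type*} {n : ℕ} (x : Fin n → X) : Finset X := Finset.univ.image x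

open scoped Classical in
/-- The number of data points equal to `y` (this is `n_k` for `y = Y_k`). -/
def clusterSize {X : Type*} {n : ℕ} (x : Fin n → X) (y : X) : ℕ :=
  (Finset.univ.filter (fun i => x i = y)).card

/-- `ψ_a(b) = ∫∫ (1 - e^{-b s}) e^{-a s} ρ_x(ds) η(dx)`. -/
def psi {X : Type*} [MeasurableSpace X] (η : Measure X) (ρ : Kernel X ℝ) (a b : ℝ) : ℝ≥0∞ :=
  ∫⁻ x, ∫⁻ s, ENNReal.ofReal ((1 - Real.exp (-(b * s))) * Real.exp (-(a * s))) ∂(ρ x) ∂η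

/-- `τ_{m,z}(a) = ∫ s^m e^{-s a} ρ_z(ds)`. -/
def tau {X : Type*} [MeasurableSpace X] (ρ : Kernel X ℝ) (m : ℕ) (z : X) (a : ℝ) : ℝ≥0∞ :=
  ∫⁻ s, ENNReal.ofReal (s ^ m * Real.exp (-(s * a))) ∂(ρ z)

/-- The jump law `s^m e^{-s a} ρ_z(ds) / τ_{m,z}(a)`. -/
def jumpLaw {X : Type*} [MeasurableSpace X] (ρ : Kernel X ℝ) (m : ℕ) (z : X) (a : ℝ) :
    Measure ℝ :=
  (tau ρ m z a)⁻¹ • (ρ z).withDensity (fun s => ENNReal.ofReal (s ^ m * Real.exp (-(s * a))))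

/-- The intensity `η(dx) e^{-s a} ρ_x(ds)`. -/
def expIntensity {X : Type*} [MeasurableSpace X] (η : Measure X) (ρ : Kernel X ℝ) (a : ℝ) :
    Measure (X × ℝ) :=
  (η ⊗ₘ ρ).withDensity (fun p => ENNReal.ofReal (Real.exp (-(p.2 * a))))

/-- `R` is the law of `μ + ∑_k J_k δ_{Y_k}`, where the `Y_k` are the distinct values of `x`, `μ` is
a completely random measure with intensity `η(dx) e^{-s a} ρ_x(ds)`, each `J_k` has the law
proportional to `s^{n_k} e^{-s a} ρ_{Y_k}(ds)`, and `μ` and all the `J_k` are independent. -/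
def IsPosteriorCRMLaw {X : Type*} [MeasurableSpace X] (η : Measure X) (ρ : Kernel X ℝ)
    (a : ℝ) {n : ℕ} (x : Fin n → X) (R : Measure (Measure X)) : Prop :=
  ∃ L : Measure (Measure X), IsCRMLaw L (expIntensity η ρ a) ∧
    R = (L.prod (Measure.pi
          (fun y : distinctValues x => jumpLaw ρ (clusterSize x y.1) y.1 a))).map
        (fun z => z.1 + ∑ y : distinctValues x, ENNReal.ofReal (z.2 y) • Measure.dirac y.1)

/-- The unnormalized density
`e^{-ψ_0(γ+u)} (∏_k τ_{n_k,Y_k}(γ+u)) u^{n+q-1}` of `U` given the data `x`. -/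
def auxWeight {X : Type*} [MeasurableSpace X] (η : Measure X) (ρ : Kernel X ℝ) (γ q : ℝ)
    {n : ℕ} (x : Fin n → X) (u : ℝ) : ℝ≥0∞ :=
  ENNReal.ofReal (Real.exp (-(psi η ρ 0 (γ + u)).toReal)) *
    (∏ y ∈ distinctValues x, tau ρ (clusterSize x y) y (γ + u)) *
    ENNReal.ofReal (u ^ ((n : ℝ) + q - 1))

/-- The normalized density of `U` given the data `x`, on `u > 0`. -/
def auxDensity {X : Type*} [MeasurableSpace X] (η : Measure X) (ρ : Kernel X ℝ) (γ q : ℝ)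
    {n : ℕ} (x : Fin n → X) (u : ℝ) : ℝ≥0∞ :=
  auxWeight η ρ γ q x u / ∫⁻ v in Ioi (0 : ℝ), auxWeight η ρ γ q x v

end

end TiltedCRM

namespace TiltedCRM

noncomputable section

open Filter Topology

/-- The function `x ↦ e^{-x}` on `[0, ∞]`. -/
def expNeg (x : ℝ≥0∞) : ℝ≥0∞ := (EReal.exp (x : EReal))⁻¹

@[simp] lemma expNeg_zero : expNeg 0 = 1 := by simp [expNeg]

@[simp] lemma expNeg_top : expNeg ∞ = 0 := by simp [expNeg]

lemma expNeg_ofReal {r : ℝ} (hr : 0 ≤ r) :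
    expNeg (ENNReal.ofReal r) = ENNReal.ofReal (Real.exp (-r)) := by
  rw [expNeg, EReal.coe_ennreal_ofReal, max_eq_left hr, EReal.exp_coe, Real.exp_neg,
    ENNReal.ofReal_inv_of_pos (Real.exp_pos _)]

lemma expNeg_add (x y : ℝ≥0∞) : expNeg (x + y) = expNeg x * expNeg y := by
  have h : ∀ z : ℝ≥0∞, EReal.exp (z : EReal) ≠ 0 := fun z => by simp
  rw [expNeg, EReal.coe_ennreal_add, EReal.exp_add, ENNReal.mul_inv (Or.inl (h x)) (Or.inr (h y))]
  rfl

lemma expNeg_le_one (x : ℝ≥0∞) : expNeg x ≤ 1 := by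
  rw [expNeg, ENNReal.inv_le_one, EReal.one_le_exp_iff]
  exact EReal.coe_ennreal_nonneg x

lemma expNeg_ne_top (x : ℝ≥0∞) : expNeg x ≠ ∞ := ((expNeg_le_one x).trans_lt ENNReal.one_lt_top).ne

lemma expNeg_antitone : Antitone expNeg := fun x y h => by
  rw [expNeg, expNeg, ENNReal.inv_le_inv, EReal.exp_le_exp_iff]
  exact EReal.coe_ennreal_le_coe_ennreal_iff.2 h

lemma expNeg_eq_zero {x : ℝ≥0∞} : expNeg x = 0 ↔ x = ∞ := by
  simp [expNeg]

lemma expNeg_injective : Function.Injective expNeg := fun x y h => by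
  have h1 := inv_injective h
  exact EReal.coe_ennreal_injective (EReal.exp_strictMono.injective h1)

lemma continuous_expNeg : Continuous expNeg := by
  unfold expNeg
  exact (ENNReal.continuous_exp.comp continuous_coe_ennreal_ereal).inv

@[fun_prop]
lemma measurable_expNeg : Measurable expNeg := continuous_expNeg.measurable

lemma expNeg_sum {ι : Type*} (s : Finset ι) (f : ι → ℝ≥0∞) :
    expNeg (∑ i ∈ s, f i) = ∏ i ∈ s, expNeg (f i) := by
  classical
  induction s using Finset.induction_on with
  | empty => simp
  | insert a s ha ih => rw [Finset.sum_insert ha, Finset.prod_insert ha, expNeg_add, ih]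

lemma expNeg_nat_mul (k : ℕ) (x : ℝ≥0∞) : expNeg (k * x) = expNeg x ^ k := by
  induction k with
  | zero => simp
  | succ k ih => rw [Nat.cast_succ, add_mul, one_mul, expNeg_add, ih, pow_succ]

lemma one_sub_expNeg_add (x y : ℝ≥0∞) :
    1 - expNeg (x + y) = (1 - expNeg x) + expNeg x * (1 - expNeg y) := by
  rw [expNeg_add, ENNReal.mul_sub (fun _ _ => expNeg_ne_top x), mul_one,
    tsub_add_tsub_cancel (expNeg_le_one x)]
  exact mul_le_of_le_one_right' (expNeg_le_one y)

lemma one_sub_expNeg_le (x : ℝ≥0∞) : 1 - expNeg x ≤ x := by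
  induction x with
  | top => simp
  | coe x =>
    have : (x : ℝ≥0∞) = ENNReal.ofReal x := by simp
    rw [this, expNeg_ofReal x.coe_nonneg, ← ENNReal.ofReal_one, ← ENNReal.ofReal_sub _ (Real.exp_pos _).le]
    apply ENNReal.ofReal_le_ofReal
    linarith [Real.add_one_le_exp (-(x : ℝ))]

/-- The approximation `2^k (1 - e^{-x / 2^k})` of `x`. -/
def dyadicDiff (k : ℕ) (x : ℝ≥0∞) : ℝ≥0∞ := 2 ^ k * (1 - expNeg (x / 2 ^ k))

lemma dyadicDiff_mono_left (x : ℝ≥0∞) : Monotone (fun k => dyadicDiff k x) := by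
  refine monotone_nat_of_le_succ fun k => ?_
  simp only [dyadicDiff]
  have h2 : x / 2 ^ k = x / 2 ^ (k + 1) + x / 2 ^ (k + 1) := by
    rw [← ENNReal.add_div, ← two_mul, pow_succ, mul_comm (2 ^ k),
      ENNReal.mul_div_mul_left _ _ (by simp) (by simp)]
  rw [h2, one_sub_expNeg_add, pow_succ, mul_assoc]
  gcongr
  rw [two_mul]
  gcongr
  exact mul_le_of_le_one_left' (expNeg_le_one _)

lemma dyadicDiff_le (k : ℕ) (x : ℝ≥0∞) : dyadicDiff k x ≤ x := by
  refine (mul_le_mul_right (one_sub_expNeg_le _) _).trans ?_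
  exact ENNReal.mul_div_le

lemma tendsto_dyadicDiff (x : ℝ≥0∞) : Tendsto (fun k => dyadicDiff k x) atTop (𝓝 x) := by
  have hpow : Tendsto (fun k : ℕ => (2 : ℝ) ^ k) atTop atTop :=
    tendsto_pow_atTop_atTop_of_one_lt (by norm_num)
  have key : ∀ k : ℕ, ∀ r : ℝ, 0 ≤ r → dyadicDiff k (ENNReal.ofReal r) =
      ENNReal.ofReal (2 ^ k * (1 - Real.exp (-(r / 2 ^ k)))) := by
    intro k r hr
    have h2 : (2 : ℝ≥0∞) ^ k = ENNReal.ofReal (2 ^ k) := by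
      rw [ENNReal.ofReal_pow (by norm_num)]; simp
    rw [dyadicDiff, h2, ← ENNReal.ofReal_div_of_pos (by positivity), expNeg_ofReal (by positivity),
      ← ENNReal.ofReal_one, ← ENNReal.ofReal_sub _ (Real.exp_pos _).le,
      ← ENNReal.ofReal_mul (by positivity)]
  induction x with
  | top =>
    have : ∀ k, dyadicDiff k ∞ = 2 ^ k := by
      intro k
      simp [dyadicDiff, ENNReal.top_div]
    simp only [this]
    exact ENNReal.tendsto_pow_atTop_nhds_top_iff.2 (by norm_num)
  | coe x =>
    have hx : (x : ℝ≥0∞) = ENNReal.ofReal x := by simp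
    simp only [hx, key _ _ x.coe_nonneg]
    refine ENNReal.tendsto_ofReal ?_
    have hd : HasDerivAt (fun t : ℝ => 1 - Real.exp (-(x * t))) x 0 := by
      have h1 : HasDerivAt (fun t : ℝ => -((x : ℝ) * t)) (-(x : ℝ)) 0 := by
        simpa using ((hasDerivAt_id (0 : ℝ)).const_mul (x : ℝ)).fun_neg
      simpa using (h1.exp).const_sub 1
    have hs := hd.tendsto_slope_zero_right
    have ht : Tendsto (fun k : ℕ => ((2 : ℝ) ^ k)⁻¹) atTop (𝓝[>] 0) :=
      tendsto_inv_atTop_nhdsGT_zero.comp hpow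
    refine (hs.comp ht).congr fun k => ?_
    simp [div_eq_mul_inv]

/-- The bounded continuous function `x ↦ e^{-∑ k_i x_i}` on `[0, ∞]^ι`. -/
def expMonomial {ι : Type*} [Fintype ι] (k : ι → ℕ) :
    BoundedContinuousFunction (ι → ℝ≥0∞) ℝ :=
  BoundedContinuousFunction.ofNormedAddCommGroup
    (fun x => ∏ i, (expNeg (x i)).toReal ^ k i)
    (by
      have h : Continuous fun x : ℝ≥0∞ => (expNeg x).toReal :=
        ENNReal.continuousOn_toReal.comp_continuous continuous_expNeg expNeg_ne_top
      exact continuous_finsetProd _ fun i _ => (h.comp (continuous_apply i)).pow _)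
    1
    (by
      intro x
      rw [Real.norm_of_nonneg (by positivity)]
      refine Finset.prod_le_one (fun i _ => by positivity) fun i _ => ?_
      refine pow_le_one₀ ENNReal.toReal_nonneg ?_
      exact ENNReal.toReal_le_of_le_ofReal zero_le_one (by simpa using expNeg_le_one (x i)))

lemma expMonomial_apply {ι : Type*} [Fintype ι] (k : ι → ℕ) (x : ι → ℝ≥0∞) :
    expMonomial k x = (expNeg (∑ i, k i * x i)).toReal := by
  simp only [expNeg_sum, expNeg_nat_mul, ENNReal.toReal_prod, ENNReal.toReal_pow]
  rfl

/-- The family of all functions `expMonomial k` as a homomorphism. -/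
def expMonomialHom (ι : Type*) [Fintype ι] :
    Multiplicative (ι → ℕ) →* BoundedContinuousFunction (ι → ℝ≥0∞) ℝ where
  toFun k := expMonomial k.toAdd
  map_one' := by
    ext x
    simp [expMonomial_apply]
  map_mul' k l := by
    ext x
    simp [expMonomial_apply, add_mul, Finset.sum_add_distrib, expNeg_add]

/-- The star subalgebra of bounded continuous functions spanned by the functions `expMonomial k`. -/
def expMonomialAlgebra (ι : Type*) [Fintype ι] :
    StarSubalgebra ℝ (BoundedContinuousFunction (ι → ℝ≥0∞) ℝ) :=
  { Algebra.adjoin ℝ (MonoidHom.mrange (expMonomialHom ι) : Set _) with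
    star_mem' := fun {a} ha => by
      have : star a = a := by ext x; simp
      rw [this]; exact ha }

/-- A finite measure on `[0, ∞]^ι` is determined by its Laplace transform on `ℕ^ι`. -/
lemma measure_ext_of_expNeg {ι : Type*} [Fintype ι] {P P' : Measure (ι → ℝ≥0∞)}
    [IsFiniteMeasure P] [IsFiniteMeasure P']
    (h : ∀ k : ι → ℕ, ∫⁻ x, expNeg (∑ i, k i * x i) ∂P = ∫⁻ x, expNeg (∑ i, k i * x i) ∂P') :
    P = P' := by
  classical
  refine ext_of_forall_mem_subalgebra_integral_eq_of_polish (𝕜 := ℝ) (A := expMonomialAlgebra ι)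
    ?_ ?_
  · intro x y hxy
    obtain ⟨i, hi⟩ := Function.ne_iff.1 hxy
    refine ⟨expMonomial (Pi.single i 1), ⟨_, ⟨expMonomial (Pi.single i 1), ?_, rfl⟩, rfl⟩, ?_⟩
    · exact Algebra.subset_adjoin ⟨Multiplicative.ofAdd (Pi.single i 1), rfl⟩
    · have h1 : ∀ z : ι → ℝ≥0∞, expMonomial (Pi.single i 1) z = (expNeg (z i)).toReal := by
        intro z
        rw [expMonomial_apply, Finset.sum_eq_single i]
        · simp
        · intro j _ hj; simp [hj]
        · simp
      rw [h1, h1]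
      intro heq
      exact hi (expNeg_injective
        ((ENNReal.toReal_eq_toReal_iff' (expNeg_ne_top _) (expNeg_ne_top _)).1 heq))
  · intro g hg
    change g ∈ Subalgebra.toSubmodule (Algebra.adjoin ℝ _) at hg
    rw [Algebra.adjoin_eq_span, Submonoid.closure_eq] at hg
    induction hg using Submodule.span_induction with
    | mem g hg =>
      obtain ⟨k, rfl⟩ := hg
      have h2 : ∀ μ : Measure (ι → ℝ≥0∞), ∫ x, expMonomialHom ι k x ∂μ
          = (∫⁻ x, expNeg (∑ i, (k.toAdd i : ℕ) * x i) ∂μ).toReal := by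
        intro μ
        rw [← integral_toReal]
        · exact integral_congr_ae (ae_of_all _ fun x => expMonomial_apply _ x)
        · exact Measurable.aemeasurable (by fun_prop)
        · exact ae_of_all _ fun x => (expNeg_ne_top _).lt_top
      rw [h2, h2, h]
    | zero => simp
    | add f g _ _ hf hg =>
      simp only [BoundedContinuousFunction.coe_add, Pi.add_apply]
      rw [integral_add (f.integrable _) (g.integrable _),
        integral_add (f.integrable _) (g.integrable _), hf, hg]
    | smul c f _ hf =>
      simp only [BoundedContinuousFunction.coe_smul]
      rw [integral_smul, integral_smul, hf]

/-- A family of `[0, ∞]`-valued random variables is independent if its Laplace transform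
factorizes. -/
lemma iIndepFun_of_expNeg {Ω ι : Type*} [MeasurableSpace Ω] [Fintype ι] {P : Measure Ω}
    [IsProbabilityMeasure P] {V : ι → Ω → ℝ≥0∞} (hV : ∀ i, Measurable (V i))
    (h : ∀ k : ι → ℕ, ∫⁻ ω, expNeg (∑ i, k i * V i ω) ∂P = ∏ i, ∫⁻ ω, expNeg (k i * V i ω) ∂P) :
    iIndepFun V P := by
  rw [iIndepFun_iff_map_fun_eq_pi_map fun i => (hV i).aemeasurable]
  have hVm : Measurable fun ω i => V i ω := measurable_pi_iff.2 hV
  have := fun i => Measure.isProbabilityMeasure_map (μ := P) (hV i).aemeasurable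
  have := Measure.isProbabilityMeasure_map (μ := P) hVm.aemeasurable
  refine measure_ext_of_expNeg fun k => ?_
  rw [lintegral_map (by fun_prop) hVm, h]
  simp only [expNeg_sum]
  have hind : iIndepFun (fun i (x : ι → ℝ≥0∞) => expNeg (k i * x i))
      (Measure.pi fun i => P.map (V i)) :=
    iIndepFun_pi (X := fun i x => expNeg (k i * x)) fun i => by fun_prop
  rw [lintegral_prod_eq_prod_lintegral_of_indepFun Finset.univ _ hind fun i => by fun_prop]
  refine Finset.prod_congr rfl fun i _ => ?_
  rw [← lintegral_map (μ := Measure.pi fun i => P.map (V i)) (f := fun x => expNeg (k i * x))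
    (g := fun x => x i) (by fun_prop) (measurable_pi_apply i),
    (measurePreserving_eval (fun i => P.map (V i)) i).map_eq,
    lintegral_map (by fun_prop) (hV i)]

/-- A finite measure on the space of measures is determined by its Laplace functional. -/
lemma measure_ext_of_laplace {Z : Type*} [MeasurableSpace Z] {P Q : Measure (Measure Z)}
    [IsFiniteMeasure P] [IsFiniteMeasure Q]
    (h : ∀ f : Z → ℝ≥0∞, Measurable f →
      ∫⁻ m, expNeg (∫⁻ z, f z ∂m) ∂P = ∫⁻ m, expNeg (∫⁻ z, f z ∂m) ∂Q) :
    P = Q := by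
  classical
  let ev : Measure Z → {B : Set Z // MeasurableSet B} → ℝ≥0∞ := fun m B => m B.1
  have hev : Measurable ev := measurable_pi_iff.2 fun B => Measure.measurable_coe B.2
  have hmap : P.map ev = Q.map ev := by
    have hR := fun I : Finset {B : Set Z // MeasurableSet B} =>
      Measure.isFiniteMeasure_map (Q.map ev) I.restrict
    refine IsProjectiveLimit.unique (P := fun I => (Q.map ev).map I.restrict)
      (fun I => ?_) fun I => rfl
    refine measure_ext_of_expNeg fun k => ?_
    have hr : Measurable (I.restrict (π := fun _ : {B : Set Z // MeasurableSet B} => ℝ≥0∞)) :=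
      measurable_pi_lambda _ fun _ => measurable_pi_apply _
    have hm : Measurable fun x : I → ℝ≥0∞ => expNeg (∑ i, k i * x i) := by fun_prop
    beta_reduce
    rw [Measure.map_map hr hev, Measure.map_map hr hev, lintegral_map hm (hr.comp hev),
      lintegral_map hm (hr.comp hev)]
    have hf : ∀ i : I, Measurable (i.1.1.indicator fun _ => (k i : ℝ≥0∞)) :=
      fun i => measurable_const.indicator i.1.2
    have key : ∀ m : Measure Z, ∑ i : I, (k i : ℝ≥0∞) * (I.restrict ∘ ev) m i
        = ∫⁻ z, ∑ i : I, i.1.1.indicator (fun _ => (k i : ℝ≥0∞)) z ∂m := by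
      intro m
      rw [lintegral_finsetSum _ fun i _ => hf i]
      refine Finset.sum_congr rfl fun i _ => ?_
      rw [lintegral_indicator_const i.1.2]
      rfl
    simp only [key]
    exact h _ (Finset.measurable_sum _ fun i _ => hf i)
  have hcomap : ∀ s : Set (Measure Z), MeasurableSet s → ∃ t, MeasurableSet t ∧ ev ⁻¹' t = s := by
    intro s hs
    have hle : (Measure.instMeasurableSpace : MeasurableSpace (Measure Z)) ≤
        MeasurableSpace.comap ev inferInstance := by
      refine iSup_le fun B => iSup_le fun hB => ?_
      rintro _ ⟨D, hD, rfl⟩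
      exact ⟨(fun x => x ⟨B, hB⟩) ⁻¹' D, measurable_pi_apply _ hD, rfl⟩
    exact hle s hs
  ext s hs
  obtain ⟨t, ht, rfl⟩ := hcomap s hs
  rw [← Measure.map_apply hev ht, hmap, Measure.map_apply hev ht]

/-- A finite measure on `[0, ∞]` is determined by its Laplace transform on `ℕ`. -/
lemma measure_ext_of_expNeg_mul {P Q : Measure ℝ≥0∞} [IsFiniteMeasure P] [IsFiniteMeasure Q]
    (h : ∀ k : ℕ, ∫⁻ x, expNeg (k * x) ∂P = ∫⁻ x, expNeg (k * x) ∂Q) : P = Q := by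
  let e : ℝ≥0∞ ≃ᵐ (Unit → ℝ≥0∞) := (MeasurableEquiv.funUnique Unit ℝ≥0∞).symm
  have := Measure.isFiniteMeasure_map P e
  have := Measure.isFiniteMeasure_map Q e
  refine (MeasurableEquiv.map_measurableEquiv_injective e) ?_
  refine measure_ext_of_expNeg fun k => ?_
  rw [lintegral_map_equiv, lintegral_map_equiv]
  simpa [e] using h (k ())

lemma lintegral_expNeg_poisson (r : NNReal) (c : ℝ≥0∞) :
    ∫⁻ n : ℕ, expNeg (c * n) ∂(poissonMeasure r) = expNeg (r * (1 - expNeg c)) := by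
  obtain ⟨y, hy0, hy⟩ : ∃ y : ℝ, 0 ≤ y ∧ expNeg c = ENNReal.ofReal y :=
    ⟨(expNeg c).toReal, ENNReal.toReal_nonneg, (ENNReal.ofReal_toReal (expNeg_ne_top c)).symm⟩
  have hy1 : y ≤ 1 := by
    have := expNeg_le_one c
    rwa [hy, ENNReal.ofReal_le_one] at this
  have hsum : HasSum (fun n : ℕ => Real.exp (-r) * (r : ℝ) ^ n / n.factorial * y ^ n)
      (Real.exp (-(r * (1 - y)))) := by
    have h1 := (NormedSpace.expSeries_div_hasSum_exp (r * y : ℝ)).mul_left (Real.exp (-r))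
    rw [← Real.exp_eq_exp_ℝ, ← Real.exp_add] at h1
    convert! h1 using 1
    · ext n; rw [mul_pow]; ring
    · ring_nf
  have hr : (r : ℝ≥0∞) = ENNReal.ofReal r := by simp
  rw [hy, ← ENNReal.ofReal_one, ← ENNReal.ofReal_sub _ hy0, hr,
    ← ENNReal.ofReal_mul r.coe_nonneg, expNeg_ofReal (by have := r.coe_nonneg; nlinarith),
    ← hsum.tsum_eq, ENNReal.ofReal_tsum_of_nonneg (fun n => by positivity) hsum.summable,
    poissonMeasure, lintegral_sum_measure]
  refine tsum_congr fun n => ?_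
  rw [lintegral_smul_measure, lintegral_dirac, mul_comm c, expNeg_nat_mul, hy, smul_eq_mul,
    ← ENNReal.ofReal_pow hy0, ← ENNReal.ofReal_mul (by positivity)]

section Poisson

variable {Z : Type*} [MeasurableSpace Z] {Q : Measure (Measure Z)} {ν : Measure Z}

lemma IsPoissonLaw.lintegral_expNeg_apply (hQ : IsPoissonLaw Q ν) {B : Set Z}
    (hB : MeasurableSet B) (hνB : ν B < ∞) (c : ℝ≥0∞) :
    ∫⁻ N, expNeg (c * N B) ∂Q = expNeg (ν B * (1 - expNeg c)) := by
  have h := hQ.poisson B hB hνB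
  rw [← lintegral_map (f := fun x => expNeg (c * x)) (g := fun N : Measure Z => N B)
    (by fun_prop) (Measure.measurable_coe hB), h, lintegral_map (by fun_prop) (by fun_prop),
    lintegral_expNeg_poisson, ENNReal.coe_toNNReal hνB.ne]

lemma IsPoissonLaw.laplace_simpleFunc (hQ : IsPoissonLaw Q ν) (f : SimpleFunc Z ℝ≥0∞)
    (hf : ∀ c ≠ 0, ν (f ⁻¹' {c}) < ∞) :
    ∫⁻ N, expNeg (∫⁻ z, f z ∂N) ∂Q = expNeg (∫⁻ z, (1 - expNeg (f z)) ∂ν) := by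
  classical
  have := hQ.isProbabilityMeasure
  let S := f.range.erase 0
  let e := S.equivFin.symm
  have hne : ∀ i, (e i : ℝ≥0∞) ≠ 0 := fun i => Finset.ne_of_mem_erase (e i).2
  let B : Fin S.card → Set Z := fun i => f ⁻¹' {(e i : ℝ≥0∞)}
  have hB : ∀ i, MeasurableSet (B i) := fun i => f.measurableSet_preimage _
  have hνB : ∀ i, ν (B i) < ∞ := fun i => hf _ (hne i)
  have hdisj : Pairwise fun i j => Disjoint (B i) (B j) := by
    intro i j hij
    refine Disjoint.preimage f ?_
    rw [disjoint_singleton]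
    exact fun h => hij (e.injective (Subtype.ext h))
  have hsum : ∀ (g : ℝ≥0∞ → ℝ≥0∞), g 0 = 0 → ∀ m : Measure Z,
      ∫⁻ z, g (f z) ∂m = ∑ i, g (e i) * m (B i) := by
    intro g hg m
    have h1 : ∫⁻ z, g (f z) ∂m = (f.map g).lintegral m := by
      rw [← SimpleFunc.lintegral_eq_lintegral]; rfl
    rw [h1, SimpleFunc.map_lintegral]
    have h2 : ∑ x ∈ f.range, g x * m (f ⁻¹' {x}) = ∑ x ∈ S, g x * m (f ⁻¹' {x}) := by
      refine (Finset.sum_subset (Finset.erase_subset _ _) fun x hx hxS => ?_).symm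
      have : x = 0 := by
        by_contra h0
        exact hxS (Finset.mem_erase.2 ⟨h0, hx⟩)
      simp [this, hg]
    rw [h2, ← Finset.sum_coe_sort S, ← e.sum_comp]
  have hind := hQ.indep _ B hB hνB hdisj
  have hind' := hind.comp (fun i x => expNeg (e i * x)) fun i => by fun_prop
  have hleft : ∀ N : Measure Z, expNeg (∫⁻ z, f z ∂N) = ∏ i, expNeg (e i * N (B i)) := by
    intro N
    rw [hsum (fun x => x) rfl, expNeg_sum]
  simp only [hleft]
  refine (lintegral_prod_eq_prod_lintegral_of_indepFun Finset.univ _ hind' fun i => ?_).trans ?_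
  · exact Measurable.comp (g := fun x => expNeg (e i * x)) (by fun_prop)
      (Measure.measurable_coe (hB i))
  · rw [hsum (fun x => 1 - expNeg x) (by simp), expNeg_sum]
    refine Finset.prod_congr rfl fun i _ => ?_
    rw [mul_comm _ (ν _)]
    exact hQ.lintegral_expNeg_apply (hB i) (hνB i) (e i)

/-- The Laplace functional of a Poisson process with σ-finite intensity. -/
lemma IsPoissonLaw.laplace [SigmaFinite ν] (hQ : IsPoissonLaw Q ν) {f : Z → ℝ≥0∞}
    (hf : Measurable f) :
    ∫⁻ N, expNeg (∫⁻ z, f z ∂N) ∂Q = expNeg (∫⁻ z, (1 - expNeg (f z)) ∂ν) := by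
  have := hQ.isProbabilityMeasure
  let S := spanningSets ν
  have hS : ∀ n, MeasurableSet (S n) := measurableSet_spanningSets ν
  let F : ℕ → SimpleFunc Z ℝ≥0∞ := fun n => (SimpleFunc.eapprox f n).restrict (S n)
  have hF : ∀ n z, F n z = (S n).indicator (SimpleFunc.eapprox f n) z := fun n z => by
    rw [SimpleFunc.restrict_apply _ (hS n)]
  have hmono : ∀ z, Monotone fun n => F n z := by
    intro z m n hmn
    simp only [hF]
    exact (indicator_le_indicator_of_subset (monotone_spanningSets ν hmn) (fun _ => zero_le)
      z).trans (indicator_le_indicator (SimpleFunc.monotone_eapprox f hmn z))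
  have hlim : ∀ z, Tendsto (fun n => F n z) atTop (𝓝 (f z)) := by
    intro z
    have h1 : Tendsto (fun n => SimpleFunc.eapprox f n z) atTop (𝓝 (f z)) := by
      rw [← SimpleFunc.iSup_eapprox_apply hf z]
      exact tendsto_atTop_iSup fun m n hmn => SimpleFunc.monotone_eapprox f hmn z
    refine h1.congr' ?_
    filter_upwards [eventually_ge_atTop (spanningSetsIndex ν z)] with n hn
    rw [hF, indicator_of_mem (monotone_spanningSets ν hn (mem_spanningSetsIndex ν z))]
  have hfin : ∀ n, ∀ c ≠ 0, ν (F n ⁻¹' {c}) < ∞ := by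
    intro n c hc
    refine (measure_mono ?_).trans_lt (measure_spanningSets_lt_top ν n)
    intro z hz
    by_contra hzS
    rw [mem_preimage, hF, indicator_of_notMem hzS] at hz
    exact hc hz.symm
  have key : ∀ n, ∫⁻ N, expNeg (∫⁻ z, F n z ∂N) ∂Q = expNeg (∫⁻ z, (1 - expNeg (F n z)) ∂ν) :=
    fun n => hQ.laplace_simpleFunc (F n) (hfin n)
  have hR : Tendsto (fun n => expNeg (∫⁻ z, (1 - expNeg (F n z)) ∂ν)) atTop
      (𝓝 (expNeg (∫⁻ z, (1 - expNeg (f z)) ∂ν))) := by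
    refine (continuous_expNeg.tendsto _).comp ?_
    refine lintegral_tendsto_of_tendsto_of_monotone (fun n => ?_) (ae_of_all _ fun z m n hmn => ?_)
      (ae_of_all _ fun z => ?_)
    · have := (F n).measurable
      exact Measurable.aemeasurable (by fun_prop)
    · exact tsub_le_tsub_left (expNeg_antitone (hmono z hmn)) _
    · exact ENNReal.Tendsto.sub tendsto_const_nhds ((continuous_expNeg.tendsto _).comp (hlim z))
        (Or.inl ENNReal.one_ne_top)
  have hL : Tendsto (fun n => ∫⁻ N, expNeg (∫⁻ z, F n z ∂N) ∂Q) atTop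
      (𝓝 (∫⁻ N, expNeg (∫⁻ z, f z ∂N) ∂Q)) := by
    refine tendsto_lintegral_of_dominated_convergence (fun _ => 1) (fun n => ?_)
      (fun n => ae_of_all _ fun N => expNeg_le_one _) (by simp) (ae_of_all _ fun N => ?_)
    · exact measurable_expNeg.comp (Measure.measurable_lintegral (F n).measurable)
    · refine (continuous_expNeg.tendsto _).comp ?_
      exact lintegral_tendsto_of_tendsto_of_monotone (fun n => (F n).measurable.aemeasurable)
        (ae_of_all _ hmono) (ae_of_all _ hlim)
  exact tendsto_nhds_unique (hL.congr key) hR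

/-- A law whose Laplace functional is that of a Poisson process is the law of a Poisson process. -/
lemma isPoissonLaw_of_laplace [IsProbabilityMeasure Q]
    (h : ∀ f : Z → ℝ≥0∞, Measurable f →
      ∫⁻ N, expNeg (∫⁻ z, f z ∂N) ∂Q = expNeg (∫⁻ z, (1 - expNeg (f z)) ∂ν)) :
    IsPoissonLaw Q ν := by
  have hone : ∀ B : Set Z, MeasurableSet B → ∀ c : ℝ≥0∞,
      ∫⁻ N, expNeg (c * N B) ∂Q = expNeg (ν B * (1 - expNeg c)) := by
    intro B hB c
    have h1 := h (B.indicator fun _ => c) (measurable_const.indicator hB)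
    simp only [lintegral_indicator_const hB] at h1
    rw [h1]
    have h2 : (fun z => 1 - expNeg (B.indicator (fun _ => c) z))
        = B.indicator fun _ => 1 - expNeg c := by
      ext z
      by_cases hz : z ∈ B <;> simp [hz]
    rw [h2, lintegral_indicator_const hB, mul_comm]
  refine ⟨inferInstance, fun B hB hνB => ?_, fun k B hB _ hdisj => ?_⟩
  · have := Measure.isProbabilityMeasure_map (μ := Q) (Measure.measurable_coe hB).aemeasurable
    refine measure_ext_of_expNeg_mul fun k => ?_
    rw [lintegral_map (by fun_prop) (Measure.measurable_coe hB), hone B hB,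
      lintegral_map (by fun_prop) (by fun_prop), lintegral_expNeg_poisson,
      ENNReal.coe_toNNReal hνB.ne]
  · refine iIndepFun_of_expNeg (fun i => Measure.measurable_coe (hB i)) fun c => ?_
    simp only [hone _ (hB _)]
    have hm : ∀ i, Measurable ((B i).indicator fun _ => (c i : ℝ≥0∞)) :=
      fun i => measurable_const.indicator (hB i)
    have h1 := h (fun z => ∑ i, (B i).indicator (fun _ => (c i : ℝ≥0∞)) z)
      (Finset.measurable_sum _ fun i _ => hm i)
    simp only [lintegral_finsetSum _ fun i _ => hm i, lintegral_indicator_const (hB _)] at h1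
    rw [h1, ← expNeg_sum]
    congr 1
    have h2 : ∀ z, 1 - expNeg (∑ i, (B i).indicator (fun _ => (c i : ℝ≥0∞)) z)
        = ∑ i, (B i).indicator (fun _ => 1 - expNeg (c i)) z := by
      intro z
      by_cases hz : ∃ i, z ∈ B i
      · obtain ⟨i, hi⟩ := hz
        have hj : ∀ j, j ≠ i → z ∉ B j := fun j hji hj =>
          (disjoint_left.1 (hdisj hji) hj) hi
        rw [Finset.sum_eq_single i (fun j _ hji => indicator_of_notMem (hj j hji) _) (by simp),
          Finset.sum_eq_single i (fun j _ hji => indicator_of_notMem (hj j hji) _) (by simp),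
          indicator_of_mem hi, indicator_of_mem hi]
      · push Not at hz
        simp [hz]
    simp only [h2]
    rw [lintegral_finsetSum _ fun i _ => measurable_const.indicator (hB i)]
    refine Finset.sum_congr rfl fun i _ => ?_
    rw [lintegral_indicator_const (hB i), mul_comm]

end Poisson

lemma tendsto_dyadicDiff_of_monotone {E : ℕ → ℝ≥0∞} {D : ℝ≥0∞} (hE : Monotone E)
    (hlim : Tendsto E atTop (𝓝 D)) : Tendsto (fun k => dyadicDiff k (E k)) atTop (𝓝 D) := by
  refine tendsto_order.2 ⟨fun a ha => ?_, fun a ha => ?_⟩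
  · obtain ⟨j, hj⟩ := ((tendsto_order.1 hlim).1 a ha).exists
    filter_upwards [(tendsto_order.1 (tendsto_dyadicDiff (E j))).1 a hj, eventually_ge_atTop j]
      with k hk hjk
    refine hk.trans_le ?_
    unfold dyadicDiff
    gcongr
    exact expNeg_antitone (ENNReal.div_le_div_right (hE hjk) _)
  · refine Eventually.of_forall fun k => ?_
    exact ((dyadicDiff_le k _).trans (hE.ge_of_tendsto hlim k)).trans_lt ha

lemma measurable_dyadicDiff (k : ℕ) : Measurable (dyadicDiff k) := by
  unfold dyadicDiff
  fun_prop

lemma lintegral_withDensity_mul {α : Type*} [MeasurableSpace α] (μ : Measure α) {w g : α → ℝ≥0∞}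
    (hw : Measurable w) (hg : Measurable g) :
    ∫⁻ x, g x ∂(μ.withDensity w) = ∫⁻ x, w x * g x ∂μ :=
  lintegral_withDensity_eq_lintegral_mul μ hw hg

@[fun_prop]
lemma measurable_lintegral_measure {α : Type*} [MeasurableSpace α] {f : α → ℝ≥0∞}
    (hf : Measurable f) : Measurable fun m : Measure α => ∫⁻ x, f x ∂m :=
  Measure.measurable_lintegral hf

/-- The exponential tilt of a Poisson process is a Poisson process with tilted intensity. -/
lemma IsPoissonLaw.tilt {Z : Type*} [MeasurableSpace Z] {Q : Measure (Measure Z)} {ν : Measure Z}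
    [SigmaFinite ν] (hQ : IsPoissonLaw Q ν) {g : Z → ℝ≥0∞} (hg : Measurable g)
    (hfin : ∫⁻ z, (1 - expNeg (g z)) ∂ν ≠ ∞) :
    IsPoissonLaw ((expNeg (∫⁻ z, (1 - expNeg (g z)) ∂ν))⁻¹ •
      Q.withDensity fun N => expNeg (∫⁻ z, g z ∂N)) (ν.withDensity fun z => expNeg (g z)) := by
  set c := ∫⁻ z, (1 - expNeg (g z)) ∂ν with hc
  have hc0 : expNeg c ≠ 0 := fun h => hfin (expNeg_eq_zero.1 h)
  have hw : Measurable fun N : Measure Z => expNeg (∫⁻ z, g z ∂N) := by fun_prop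
  have hprob : IsProbabilityMeasure ((expNeg c)⁻¹ •
      Q.withDensity fun N => expNeg (∫⁻ z, g z ∂N)) := by
    constructor
    rw [Measure.smul_apply, withDensity_apply _ MeasurableSet.univ, Measure.restrict_univ,
      hQ.laplace hg, ← hc, smul_eq_mul, ENNReal.inv_mul_cancel hc0 (expNeg_ne_top c)]
  refine isPoissonLaw_of_laplace fun f hf => ?_
  rw [lintegral_smul_measure, lintegral_withDensity_mul _ hw (by fun_prop),
    lintegral_withDensity_mul _ (by fun_prop) (by fun_prop)]
  have h1 : ∀ N : Measure Z, expNeg (∫⁻ z, g z ∂N) * expNeg (∫⁻ z, f z ∂N)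
      = expNeg (∫⁻ z, g z + f z ∂N) := fun N => by
    rw [lintegral_add_left hg, expNeg_add]
  simp only [h1]
  rw [hQ.laplace (f := fun z => g z + f z) (by fun_prop)]
  simp only [one_sub_expNeg_add]
  rw [lintegral_add_left (by fun_prop), ← hc, expNeg_add, smul_eq_mul, ← mul_assoc,
    ENNReal.inv_mul_cancel hc0 (expNeg_ne_top c), one_mul]

section CRM

variable {X : Type*} [MeasurableSpace X] {L : Measure (Measure X)} {ν : Measure (X × ℝ)}

lemma measurable_jumpSum : Measurable (jumpSum : Measure (X × ℝ) → Measure X) := by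
  refine Measure.measurable_of_measurable_coe _ fun A hA => ?_
  have : ∀ N : Measure (X × ℝ), jumpSum N A
      = ∫⁻ p, (Prod.fst ⁻¹' A).indicator (fun p => ENNReal.ofReal p.2) p ∂N := fun N => by
    rw [jumpSum, Measure.map_apply measurable_fst hA, withDensity_apply _ (measurable_fst hA),
      lintegral_indicator (measurable_fst hA)]
  simp only [this]
  exact Measure.measurable_lintegral
    (Measurable.indicator (by fun_prop) (measurable_fst hA))

lemma lintegral_jumpSum (N : Measure (X × ℝ)) {f : X → ℝ≥0∞} (hf : Measurable f) :
    ∫⁻ x, f x ∂(jumpSum N) = ∫⁻ p, f p.1 * ENNReal.ofReal p.2 ∂N := by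
  rw [jumpSum, lintegral_map hf measurable_fst,
    lintegral_withDensity_mul _ (by fun_prop) (by fun_prop)]
  simp only [mul_comm]

/-- The Laplace exponent `∫ (1 - e^{-s f(x)}) ν(dx, ds)`. -/
def crmExponent (ν : Measure (X × ℝ)) (f : X → ℝ≥0∞) : ℝ≥0∞ :=
  ∫⁻ p, (1 - expNeg (f p.1 * ENNReal.ofReal p.2)) ∂ν

lemma IsCRMLaw.isProbabilityMeasure (hL : IsCRMLaw L ν) : IsProbabilityMeasure L := by
  obtain ⟨Q, hQ, rfl⟩ := hL
  have := hQ.isProbabilityMeasure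
  exact Measure.isProbabilityMeasure_map measurable_jumpSum.aemeasurable

/-- The Laplace functional of a completely random measure. -/
lemma IsCRMLaw.laplace [SigmaFinite ν] (hL : IsCRMLaw L ν) {f : X → ℝ≥0∞} (hf : Measurable f) :
    ∫⁻ m, expNeg (∫⁻ x, f x ∂m) ∂L = expNeg (crmExponent ν f) := by
  obtain ⟨Q, hQ, rfl⟩ := hL
  rw [lintegral_map (by fun_prop) measurable_jumpSum]
  simp only [lintegral_jumpSum _ hf]
  exact hQ.laplace (f := fun p => f p.1 * ENNReal.ofReal p.2) (by fun_prop)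

lemma crmExponent_add (ν : Measure (X × ℝ)) {f g : X → ℝ≥0∞} (hf : Measurable f) :
    crmExponent ν (fun x => f x + g x) = crmExponent ν f +
      ∫⁻ p, expNeg (f p.1 * ENNReal.ofReal p.2) *
        (1 - expNeg (g p.1 * ENNReal.ofReal p.2)) ∂ν := by
  simp only [crmExponent, add_mul, one_sub_expNeg_add]
  rw [lintegral_add_left (by fun_prop)]

/-- The exponential tilt `e^{-a μ(X)} L(dμ) / E[e^{-a μ(X)}]` of a completely random measure. -/
def expTilt (L : Measure (Measure X)) (ν : Measure (X × ℝ)) (a : ℝ≥0∞) : Measure (Measure X) :=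
  L.withDensity fun m => (expNeg (crmExponent ν fun _ => a))⁻¹ * expNeg (a * m univ)

lemma measurable_expNeg_mul_univ (a : ℝ≥0∞) :
    Measurable fun m : Measure X => expNeg (a * m univ) :=
  measurable_expNeg.comp ((Measure.measurable_coe MeasurableSet.univ).const_mul a)

lemma IsCRMLaw.expTilt [SigmaFinite ν] (hL : IsCRMLaw L ν) {a : ℝ≥0∞}
    (ha : crmExponent ν (fun _ => a) ≠ ∞) :
    IsCRMLaw (expTilt L ν a) (ν.withDensity fun p => expNeg (a * ENNReal.ofReal p.2)) := by
  obtain ⟨Q, hQ, rfl⟩ := hL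
  refine ⟨_, hQ.tilt (g := fun p => a * ENNReal.ofReal p.2) (by fun_prop) ha, ?_⟩
  ext A hA
  have h1 : ∀ N : Measure (X × ℝ), a * jumpSum N univ = ∫⁻ p, a * ENNReal.ofReal p.2 ∂N := by
    intro N
    rw [← lintegral_jumpSum N (f := fun _ => a) measurable_const]
    simp
  have h2 := measurable_jumpSum hA
  rw [TiltedCRM.expTilt, withDensity_apply _ hA,
    lintegral_const_mul _ (measurable_expNeg_mul_univ a),
    setLIntegral_map hA (measurable_expNeg_mul_univ a) measurable_jumpSum,
    Measure.map_apply measurable_jumpSum hA, Measure.smul_apply, withDensity_apply _ h2,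
    smul_eq_mul]
  simp only [h1]
  rfl

/-- The Palm formula for a completely random measure, in terms of Laplace functionals. -/
lemma IsCRMLaw.palm_laplace [SigmaFinite ν] (hL : IsCRMLaw L ν) {f h : X → ℝ≥0∞}
    (hf : Measurable f) (hh : Measurable h) :
    ∫⁻ m, (∫⁻ x, h x ∂m) * expNeg (∫⁻ x, f x ∂m) ∂L = expNeg (crmExponent ν f) *
      ∫⁻ p, expNeg (f p.1 * ENNReal.ofReal p.2) * (h p.1 * ENNReal.ofReal p.2) ∂ν := by
  have := hL.isProbabilityMeasure
  have hlim1 : Tendsto (fun k => ∫⁻ m, dyadicDiff k (∫⁻ x, h x ∂m) * expNeg (∫⁻ x, f x ∂m) ∂L)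
      atTop (𝓝 (∫⁻ m, (∫⁻ x, h x ∂m) * expNeg (∫⁻ x, f x ∂m) ∂L)) := by
    refine lintegral_tendsto_of_tendsto_of_monotone (fun k => ?_)
      (ae_of_all _ fun m i j hij => ?_) (ae_of_all _ fun m => ?_)
    · have := measurable_dyadicDiff k
      exact Measurable.aemeasurable (by fun_prop)
    · exact mul_le_mul_left (dyadicDiff_mono_left _ hij) _
    · exact ENNReal.Tendsto.mul_const (tendsto_dyadicDiff _) (Or.inr (expNeg_ne_top _))
  let E : ℕ → ℝ≥0∞ := fun k =>
    ∫⁻ p, expNeg (f p.1 * ENNReal.ofReal p.2) * dyadicDiff k (h p.1 * ENNReal.ofReal p.2) ∂ν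
  have hEmono : Monotone E := fun i j hij =>
    lintegral_mono fun p => mul_le_mul_right (dyadicDiff_mono_left _ hij) _
  have hElim : Tendsto E atTop (𝓝 (∫⁻ p, expNeg (f p.1 * ENNReal.ofReal p.2) *
      (h p.1 * ENNReal.ofReal p.2) ∂ν)) := by
    refine lintegral_tendsto_of_tendsto_of_monotone (fun k => ?_)
      (ae_of_all _ fun p i j hij => ?_) (ae_of_all _ fun p => ?_)
    · have := measurable_dyadicDiff k
      exact Measurable.aemeasurable (by fun_prop)
    · exact mul_le_mul_right (dyadicDiff_mono_left _ hij) _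
    · exact ENNReal.Tendsto.const_mul (tendsto_dyadicDiff _) (Or.inr (expNeg_ne_top _))
  have hlim2 : Tendsto (fun k => expNeg (crmExponent ν f) * dyadicDiff k (E k)) atTop
      (𝓝 (expNeg (crmExponent ν f) * ∫⁻ p, expNeg (f p.1 * ENNReal.ofReal p.2) *
        (h p.1 * ENNReal.ofReal p.2) ∂ν)) :=
    ENNReal.Tendsto.const_mul (tendsto_dyadicDiff_of_monotone hEmono hElim)
      (Or.inr (expNeg_ne_top _))
  refine tendsto_nhds_unique hlim1 (hlim2.congr fun k => ?_)
  have hk0 : (2 : ℝ≥0∞) ^ k ≠ 0 := by simp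
  have hkt : (2 : ℝ≥0∞) ^ k ≠ ∞ := by simp
  have hpt : ∀ m : Measure X, dyadicDiff k (∫⁻ x, h x ∂m) * expNeg (∫⁻ x, f x ∂m)
      = 2 ^ k * (expNeg (∫⁻ x, f x ∂m) - expNeg (∫⁻ x, (f x + h x / 2 ^ k) ∂m)) := by
    intro m
    rw [lintegral_add_left hf, expNeg_add]
    simp only [div_eq_mul_inv]
    rw [lintegral_mul_const _ hh, dyadicDiff, div_eq_mul_inv, mul_assoc, mul_comm _ (expNeg _),
      ENNReal.mul_sub (fun _ _ => expNeg_ne_top _), mul_one]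
  simp only [hpt]
  rw [lintegral_const_mul _ (by fun_prop), lintegral_sub (by fun_prop), hL.laplace hf,
    hL.laplace (f := fun x => f x + h x / 2 ^ k) (by fun_prop), crmExponent_add _ hf, expNeg_add]
  · have hE : E k = 2 ^ k * ∫⁻ p, expNeg (f p.1 * ENNReal.ofReal p.2) *
        (1 - expNeg (h p.1 / 2 ^ k * ENNReal.ofReal p.2)) ∂ν := by
      rw [← lintegral_const_mul _ (by fun_prop)]
      refine lintegral_congr fun p => ?_
      rw [dyadicDiff, mul_left_comm, ENNReal.mul_div_right_comm]
    rw [hE, dyadicDiff, mul_comm (2 ^ k) (lintegral _ _), ENNReal.mul_div_cancel_right hk0 hkt, mul_left_comm,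
      ENNReal.mul_sub (fun _ _ => expNeg_ne_top _), mul_one]
  · exact ((lintegral_mono fun m => expNeg_le_one _).trans_lt (by simp)).ne
  · exact ae_of_all _ fun m => expNeg_antitone (lintegral_mono fun x => le_self_add)

end CRM

lemma ennreal_pow_mul_expNeg (m : ℕ) {a s : ℝ} (ha : 0 ≤ a) (hs : 0 ≤ s) :
    ENNReal.ofReal (s ^ m * Real.exp (-(s * a))) =
      ENNReal.ofReal s ^ m * expNeg (ENNReal.ofReal a * ENNReal.ofReal s) := by
  rw [← ENNReal.ofReal_mul ha, expNeg_ofReal (mul_nonneg ha hs), ← ENNReal.ofReal_pow hs,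
    ← ENNReal.ofReal_mul (by positivity), mul_comm a]

lemma pow_mul_exp_neg_le (k : ℕ) {a s : ℝ} (ha : 0 < a) (hs : 0 ≤ s) :
    s ^ k * Real.exp (-(s * a)) ≤ k.factorial / a ^ k := by
  have h := Real.pow_div_factorial_le_exp (s * a) (by positivity) k
  rw [div_le_iff₀ (by positivity)] at h
  rw [Real.exp_neg, ← div_eq_mul_inv, div_le_div_iff₀ (Real.exp_pos _) (by positivity), ← mul_pow]
  linarith

/-- The function `s ↦ s^{m+1} e^{-a s}` is dominated by a multiple of `1 - e^{-s}`. -/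
lemma exists_pow_mul_expNeg_le (m : ℕ) {a : ℝ} (ha : 0 < a) : ∃ C : ℝ≥0∞, C ≠ ∞ ∧
    ∀ s : ℝ, 0 < s → ENNReal.ofReal s ^ (m + 1) * expNeg (ENNReal.ofReal a * ENNReal.ofReal s) ≤
      C * (1 - expNeg (ENNReal.ofReal s)) := by
  set c : ℝ := m.factorial / a ^ m + (m + 1).factorial / a ^ (m + 1) with hc
  have hc0 : 0 ≤ c := by positivity
  refine ⟨ENNReal.ofReal c, ENNReal.ofReal_ne_top, fun s hs => ?_⟩
  rw [← ennreal_pow_mul_expNeg _ ha.le hs.le, expNeg_ofReal hs.le, ← ENNReal.ofReal_one,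
    ← ENNReal.ofReal_sub _ (Real.exp_pos _).le, ← ENNReal.ofReal_mul hc0]
  refine ENNReal.ofReal_le_ofReal ?_
  have h1 := pow_mul_exp_neg_le m ha hs.le
  have h2 := pow_mul_exp_neg_le (m + 1) ha hs.le
  have h3 : s / (1 + s) ≤ 1 - Real.exp (-s) := by
    have h4 : Real.exp (-s) ≤ 1 / (1 + s) := by
      rw [Real.exp_neg, ← one_div]
      exact one_div_le_one_div_of_le (by linarith) (by linarith [Real.add_one_le_exp s])
    have h5 : s / (1 + s) = 1 - 1 / (1 + s) := by field_simp; ring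
    linarith
  calc s ^ (m + 1) * Real.exp (-(s * a))
      = (s ^ m * Real.exp (-(s * a)) + s ^ (m + 1) * Real.exp (-(s * a))) * (s / (1 + s)) := by
        field_simp
        ring
    _ ≤ c * (s / (1 + s)) := by
        gcongr
        exact add_le_add h1 h2
    _ ≤ c * (1 - Real.exp (-s)) := by gcongr

section Intensity

variable {X : Type*} [MeasurableSpace X] {η : Measure X} {ρ : Kernel X ℝ}

/-- The moment `∫ s^m e^{-c s} ρ_z(ds)` with an extended parameter `c`. -/
def expMoment (ρ : Kernel X ℝ) (m : ℕ) (z : X) (c : ℝ≥0∞) : ℝ≥0∞ :=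
  ∫⁻ s, ENNReal.ofReal s ^ m * expNeg (c * ENNReal.ofReal s) ∂(ρ z)

lemma ae_pos_of_Iic {μ : Measure ℝ} (h : μ (Iic 0) = 0) : ∀ᵐ s ∂μ, 0 < s := by
  rw [ae_iff]
  simpa [Iic] using h

lemma tau_eq_expMoment (hρ : ∀ x, ρ x (Iic 0) = 0) (m : ℕ) (z : X) {a : ℝ} (ha : 0 ≤ a) :
    tau ρ m z a = expMoment ρ m z (ENNReal.ofReal a) := by
  refine lintegral_congr_ae ?_
  filter_upwards [ae_pos_of_Iic (hρ z)] with s hs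
  exact ennreal_pow_mul_expNeg m ha hs.le

lemma jumpLaw_eq (hρ : ∀ x, ρ x (Iic 0) = 0) (m : ℕ) (z : X) {a : ℝ} (ha : 0 ≤ a) :
    jumpLaw ρ m z a = (expMoment ρ m z (ENNReal.ofReal a))⁻¹ • (ρ z).withDensity
      fun s => ENNReal.ofReal s ^ m * expNeg (ENNReal.ofReal a * ENNReal.ofReal s) := by
  rw [jumpLaw, tau_eq_expMoment hρ m z ha]
  congr 1
  refine withDensity_congr_ae ?_
  filter_upwards [ae_pos_of_Iic (hρ z)] with s hs
  exact ennreal_pow_mul_expNeg m ha hs.le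

lemma ae_compProd_pos [SFinite η] [IsSFiniteKernel ρ] (hρ : ∀ x, ρ x (Iic 0) = 0) :
    ∀ᵐ p ∂(η ⊗ₘ ρ), 0 < p.2 :=
  Measure.ae_compProd_of_ae_ae (measurableSet_lt measurable_const measurable_snd)
    (ae_of_all _ fun x => ae_pos_of_Iic (hρ x))

lemma expIntensity_eq [SFinite η] [IsSFiniteKernel ρ] (hρ : ∀ x, ρ x (Iic 0) = 0) {a : ℝ}
    (ha : 0 ≤ a) : expIntensity η ρ a =
      (η ⊗ₘ ρ).withDensity fun p => expNeg (ENNReal.ofReal a * ENNReal.ofReal p.2) := by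
  refine withDensity_congr_ae ?_
  filter_upwards [ae_compProd_pos hρ] with p hp
  simpa using ennreal_pow_mul_expNeg 0 ha hp.le

lemma psi_zero_eq_crmExponent [SFinite η] [IsSFiniteKernel ρ] (hρ : ∀ x, ρ x (Iic 0) = 0) {b : ℝ}
    (hb : 0 ≤ b) : psi η ρ 0 b = crmExponent (η ⊗ₘ ρ) fun _ => ENNReal.ofReal b := by
  rw [crmExponent, Measure.lintegral_compProd (by fun_prop), psi]
  refine lintegral_congr fun x => lintegral_congr_ae ?_
  filter_upwards [ae_pos_of_Iic (hρ x)] with s hs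
  rw [← ENNReal.ofReal_mul hb, expNeg_ofReal (by positivity), ← ENNReal.ofReal_one,
    ← ENNReal.ofReal_sub _ (Real.exp_pos _).le]
  simp

lemma sigmaFinite_intensity {X : Type*} [MetricSpace X] [MeasurableSpace X] [BorelSpace X]
    {η : Measure X} [IsProbabilityMeasure η] {ρ : Kernel X ℝ} [IsSFiniteKernel ρ]
    (hρ : ∀ x, ρ x (Iic 0) = 0)
    (hν : ∀ A : Set X, MeasurableSet A → Bornology.IsBounded A → ∀ t : ℝ, 0 < t →
      ∫⁻ p in A ×ˢ univ, ENNReal.ofReal (min p.2 t) ∂(η ⊗ₘ ρ) < ∞) :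
    SigmaFinite (η ⊗ₘ ρ) := by
  obtain ⟨x₀⟩ : Nonempty X := nonempty_of_isProbabilityMeasure η
  let S : ℕ → Set (X × ℝ) := fun n => Metric.ball x₀ n ×ˢ Ioi ((n : ℝ) + 1)⁻¹
  have hS : ∀ n, MeasurableSet (S n) := fun n => measurableSet_ball.prod measurableSet_Ioi
  let N : Set (X × ℝ) := univ ×ˢ Iic 0
  have hN : (η ⊗ₘ ρ) N = 0 := by
    have := ae_compProd_pos (η := η) hρ
    rw [ae_iff] at this
    refine measure_mono_null (fun p hp => ?_) this
    simpa [N] using hp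
  refine ⟨⟨⟨fun n => S n ∪ N, fun n => trivial, fun n => ?_, ?_⟩⟩⟩
  · refine (measure_union_le _ _).trans_lt ?_
    rw [hN, add_zero]
    set δ : ℝ := ((n : ℝ) + 1)⁻¹ with hδ
    have hδ0 : 0 < δ := by positivity
    have h1 := hν (Metric.ball x₀ n) measurableSet_ball Metric.isBounded_ball δ hδ0
    have h2 : ENNReal.ofReal δ * (η ⊗ₘ ρ) (S n) ≤
        ∫⁻ p in Metric.ball x₀ n ×ˢ univ, ENNReal.ofReal (min p.2 δ) ∂(η ⊗ₘ ρ) := by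
      rw [← setLIntegral_const]
      refine (setLIntegral_mono_ae (Measurable.aemeasurable (by fun_prop))
        (ae_of_all _ fun p hp => ?_)).trans
        (lintegral_mono_set (prod_mono_right (subset_univ _)))
      exact ENNReal.ofReal_le_ofReal (le_min hp.2.le le_rfl)
    by_contra htop
    rw [not_lt, top_le_iff] at htop
    rw [htop, ENNReal.mul_top (by simpa using hδ0)] at h2
    exact (h2.trans_lt h1).ne rfl
  · refine eq_univ_of_forall fun p => ?_
    rw [mem_iUnion]
    by_cases hp : p.2 ≤ 0
    · exact ⟨0, Or.inr ⟨trivial, hp⟩⟩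
    · push Not at hp
      obtain ⟨n, hn⟩ := exists_nat_gt (max (dist p.1 x₀) (p.2⁻¹))
      refine ⟨n, Or.inl ⟨(le_max_left _ _).trans_lt hn, ?_⟩⟩
      exact inv_lt_of_inv_lt₀ hp (((le_max_right _ _).trans_lt hn).trans (by linarith))

lemma crmExponent_ne_top_of_ae_lt_top {L : Measure (Measure X)} {ν : Measure (X × ℝ)}
    [SigmaFinite ν] (hL : IsCRMLaw L ν) (hT : ∀ᵐ m ∂L, m univ < ∞) {a : ℝ≥0∞} (ha : a ≠ ∞) :
    crmExponent ν (fun _ => a) ≠ ∞ := by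
  intro h
  have := hL.isProbabilityMeasure
  have h1 := hL.laplace (f := fun _ => a) measurable_const
  rw [h, expNeg_top, lintegral_eq_zero_iff (by fun_prop)] at h1
  obtain ⟨m, hm, hm'⟩ := (h1.and hT).exists
  simp only [lintegral_const, Pi.zero_apply, expNeg_eq_zero] at hm
  exact ENNReal.mul_ne_top ha hm'.ne hm

/-- The fibres `z` at which the Lévy exponent is finite. -/
def finiteFibre (ρ : Kernel X ℝ) : Set X :=
  {z | ∫⁻ s, (1 - expNeg (ENNReal.ofReal s)) ∂(ρ z) < ∞}

lemma measurableSet_finiteFibre : MeasurableSet (finiteFibre ρ) :=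
  measurableSet_lt (Measurable.lintegral_kernel (by fun_prop)) measurable_const

lemma ae_mem_finiteFibre [SFinite η] [IsSFiniteKernel ρ]
    (h : crmExponent (η ⊗ₘ ρ) (fun _ => 1) ≠ ∞) : ∀ᵐ z ∂η, z ∈ finiteFibre ρ := by
  rw [crmExponent, Measure.lintegral_compProd (by fun_prop)] at h
  simp only [one_mul] at h
  exact ae_lt_top (Measurable.lintegral_kernel (by fun_prop)) h

lemma expMoment_lt_top (hρ : ∀ x, ρ x (Iic 0) = 0) {z : X} (hz : z ∈ finiteFibre ρ) {m : ℕ}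
    (hm : m ≠ 0) {a : ℝ} (ha : 0 < a) : expMoment ρ m z (ENNReal.ofReal a) < ∞ := by
  obtain ⟨k, rfl⟩ := Nat.exists_eq_succ_of_ne_zero hm
  obtain ⟨C, hC, hle⟩ := exists_pow_mul_expNeg_le k ha
  calc expMoment ρ (k + 1) z (ENNReal.ofReal a)
      ≤ ∫⁻ s, C * (1 - expNeg (ENNReal.ofReal s)) ∂(ρ z) := by
        refine lintegral_mono_ae ?_
        filter_upwards [ae_pos_of_Iic (hρ z)] with s hs using hle s hs
    _ = C * ∫⁻ s, (1 - expNeg (ENNReal.ofReal s)) ∂(ρ z) := lintegral_const_mul' _ _ hC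
    _ < ∞ := ENNReal.mul_lt_top hC.lt_top hz

lemma lintegral_mul_expNeg_intensity_ne_top [SFinite η] [IsSFiniteKernel ρ]
    (hρ : ∀ x, ρ x (Iic 0) = 0) (h : crmExponent (η ⊗ₘ ρ) (fun _ => 1) ≠ ∞) {a : ℝ} (ha : 0 < a) :
    ∫⁻ p, ENNReal.ofReal p.2 * expNeg (ENNReal.ofReal a * ENNReal.ofReal p.2) ∂(η ⊗ₘ ρ) ≠ ∞ := by
  obtain ⟨C, hC, hle⟩ := exists_pow_mul_expNeg_le 0 ha
  have h1 : ∫⁻ p, ENNReal.ofReal p.2 * expNeg (ENNReal.ofReal a * ENNReal.ofReal p.2) ∂(η ⊗ₘ ρ)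
      ≤ ∫⁻ p, C * (1 - expNeg (1 * ENNReal.ofReal p.2)) ∂(η ⊗ₘ ρ) := by
    refine lintegral_mono_ae ?_
    filter_upwards [ae_compProd_pos hρ] with p hp
    simpa using hle p.2 hp
  rw [lintegral_const_mul' _ _ hC] at h1
  exact (h1.trans_lt (ENNReal.mul_lt_top hC.lt_top h.lt_top)).ne

end Intensity

/-- The random measure obtained from `(μ, s)` by adding atoms of mass `s i` at `y i`. -/
def addAtoms {X ι : Type*} [MeasurableSpace X] [Fintype ι] (y : ι → X)
    (z : Measure X × (ι → ℝ)) : Measure X :=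
  z.1 + ∑ i, ENNReal.ofReal (z.2 i) • Measure.dirac (y i)

section AddAtoms

variable {X ι : Type*} [MeasurableSpace X] [Fintype ι]

lemma measurable_addAtoms (y : ι → X) : Measurable (addAtoms y) := by
  refine Measure.measurable_of_measurable_coe _ fun A hA => ?_
  simp only [addAtoms, Measure.add_apply, Measure.finsetSum_apply, Measure.smul_apply, smul_eq_mul]
  have h1 : Measurable fun z : Measure X × (ι → ℝ) => z.1 A :=
    (Measure.measurable_coe hA).comp measurable_fst
  refine h1.add (Finset.measurable_sum _ fun i _ => ?_)
  fun_prop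

lemma lintegral_addAtoms (y : ι → X) (z : Measure X × (ι → ℝ)) {f : X → ℝ≥0∞}
    (hf : Measurable f) :
    ∫⁻ x, f x ∂(addAtoms y z) = ∫⁻ x, f x ∂z.1 + ∑ i, f (y i) * ENNReal.ofReal (z.2 i) := by
  rw [addAtoms, lintegral_add_measure, lintegral_finsetSum_measure]
  congr 1
  refine Finset.sum_congr rfl fun i _ => ?_
  rw [lintegral_smul_measure, lintegral_dirac' _ hf, smul_eq_mul, mul_comm]

lemma lintegral_prod_pi {J : ι → Measure ℝ} [∀ i, IsProbabilityMeasure (J i)]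
    {g : ι → ℝ → ℝ≥0∞} (hg : ∀ i, Measurable (g i)) :
    ∫⁻ s, ∏ i, g i (s i) ∂(Measure.pi J) = ∏ i, ∫⁻ s, g i s ∂(J i) := by
  have hind : iIndepFun (fun i (s : ι → ℝ) => g i (s i)) (Measure.pi J) :=
    iIndepFun_pi fun i => (hg i).aemeasurable
  rw [lintegral_prod_eq_prod_lintegral_of_indepFun Finset.univ _ hind
    fun i => (hg i).comp (measurable_pi_apply i)]
  refine Finset.prod_congr rfl fun i _ => ?_
  rw [← lintegral_map (μ := Measure.pi J) (f := g i) (g := fun s => s i) (hg i)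
    (measurable_pi_apply i), (measurePreserving_eval J i).map_eq]

variable {L : Measure (Measure X)} {J : ι → Measure ℝ}
  [∀ i, IsProbabilityMeasure (J i)]

instance isProbabilityMeasure_map_addAtoms [IsProbabilityMeasure L] (y : ι → X) :
    IsProbabilityMeasure ((L.prod (Measure.pi J)).map (addAtoms y)) :=
  Measure.isProbabilityMeasure_map (measurable_addAtoms y).aemeasurable

lemma laplace_map_addAtoms (y : ι → X) {f : X → ℝ≥0∞} (hf : Measurable f) :
    ∫⁻ m, expNeg (∫⁻ x, f x ∂m) ∂((L.prod (Measure.pi J)).map (addAtoms y)) =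
      (∫⁻ m, expNeg (∫⁻ x, f x ∂m) ∂L) *
        ∏ i, ∫⁻ s, expNeg (f (y i) * ENNReal.ofReal s) ∂(J i) := by
  rw [lintegral_map (by fun_prop) (measurable_addAtoms y)]
  simp only [lintegral_addAtoms y _ hf, expNeg_add, expNeg_sum]
  rw [lintegral_prod_mul (f := fun m => expNeg (∫⁻ x, f x ∂m))
    (g := fun s : ι → ℝ => ∏ i, expNeg (f (y i) * ENNReal.ofReal (s i))) (by fun_prop)
    (Measurable.aemeasurable (by fun_prop)), lintegral_prod_pi (g := fun i s => expNeg (f (y i) * ENNReal.ofReal s))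
    fun i => by fun_prop]

open scoped Classical in
lemma palm_laplace_map_addAtoms (y : ι → X) {f h : X → ℝ≥0∞} (hf : Measurable f)
    (hh : Measurable h) :
    ∫⁻ m, (∫⁻ x, h x ∂m) * expNeg (∫⁻ x, f x ∂m) ∂((L.prod (Measure.pi J)).map (addAtoms y)) =
      (∫⁻ m, (∫⁻ x, h x ∂m) * expNeg (∫⁻ x, f x ∂m) ∂L) *
        (∏ i, ∫⁻ s, expNeg (f (y i) * ENNReal.ofReal s) ∂(J i)) +
      (∫⁻ m, expNeg (∫⁻ x, f x ∂m) ∂L) * ∑ j, h (y j) *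
        ∏ i, ∫⁻ s, (if i = j then ENNReal.ofReal s else 1) *
          expNeg (f (y i) * ENNReal.ofReal s) ∂(J i) := by
  have hexp : ∀ i, Measurable fun s : ℝ => expNeg (f (y i) * ENNReal.ofReal s) :=
    fun i => by fun_prop
  have hite : ∀ i j : ι, Measurable fun s : ℝ => (if i = j then ENNReal.ofReal s else 1) *
      expNeg (f (y i) * ENNReal.ofReal s) := by
    intro i j
    split_ifs <;> fun_prop
  have hpt : ∀ z : Measure X × (ι → ℝ),
      (∫⁻ x, h x ∂(addAtoms y z)) * expNeg (∫⁻ x, f x ∂(addAtoms y z)) =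
      ((∫⁻ x, h x ∂z.1) * expNeg (∫⁻ x, f x ∂z.1)) *
        (∏ i, expNeg (f (y i) * ENNReal.ofReal (z.2 i))) +
      ∑ j, expNeg (∫⁻ x, f x ∂z.1) * (h (y j) * ∏ i, ((if i = j then ENNReal.ofReal (z.2 i) else 1) *
          expNeg (f (y i) * ENNReal.ofReal (z.2 i)))) := by
    intro z
    rw [lintegral_addAtoms y z hf, lintegral_addAtoms y z hh, expNeg_add, expNeg_sum, add_mul]
    congr 1
    · ring
    · rw [Finset.sum_mul]
      refine Finset.sum_congr rfl fun j _ => ?_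
      rw [Finset.prod_mul_distrib, Finset.prod_ite_eq' Finset.univ j]
      simp only [Finset.mem_univ, if_true]
      ring
  have hp : ∀ j, Measurable fun s : ι → ℝ => ∏ i, ((if i = j then ENNReal.ofReal (s i) else 1) *
      expNeg (f (y i) * ENNReal.ofReal (s i))) :=
    fun j => Finset.measurable_prod _ fun i _ => (hite i j).comp (measurable_pi_apply i)
  rw [lintegral_map (by fun_prop) (measurable_addAtoms y)]
  simp only [hpt]
  rw [lintegral_add_left (by fun_prop), lintegral_finsetSum _ fun j _ => by
    have h1 : Measurable fun z : Measure X × (ι → ℝ) => h (y j) * ∏ i,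
        ((if i = j then ENNReal.ofReal (z.2 i) else 1) *
          expNeg (f (y i) * ENNReal.ofReal (z.2 i))) := ((hp j).comp measurable_snd).const_mul _
    have h2 : Measurable fun z : Measure X × (ι → ℝ) => expNeg (∫⁻ x, f x ∂z.1) := by fun_prop
    exact h2.mul h1, lintegral_prod_mul (f := fun m => (∫⁻ x, h x ∂m) * expNeg (∫⁻ x, f x ∂m))
    (g := fun s : ι → ℝ => ∏ i, expNeg (f (y i) * ENNReal.ofReal (s i))) (by fun_prop)
    (Measurable.aemeasurable (by fun_prop)), lintegral_prod_pi hexp]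
  congr 1
  rw [Finset.mul_sum]
  refine Finset.sum_congr rfl fun j _ => ?_
  rw [lintegral_prod_mul (f := fun m => expNeg (∫⁻ x, f x ∂m))
    (g := fun s : ι → ℝ => h (y j) * ∏ i, ((if i = j then ENNReal.ofReal (s i) else 1) *
          expNeg (f (y i) * ENNReal.ofReal (s i)))) (by fun_prop)
    ((hp j).const_mul _).aemeasurable, lintegral_const_mul _ (hp j),
    lintegral_prod_pi fun i => hite i j]

end AddAtoms

section Kernel

variable {X T : Type*} [MeasurableSpace X] [MeasurableSpace T]

/-- Adding one independent atom to a random measure, as an operation on kernels. -/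
lemma exists_kernel_addAtom (κ : Kernel T (Measure X)) [IsMarkovKernel κ] (K : Kernel T ℝ)
    [IsMarkovKernel K] {y : T → X} (hy : Measurable y) :
    ∃ κ' : Kernel T (Measure X), IsMarkovKernel κ' ∧ ∀ t, ∀ f : X → ℝ≥0∞, Measurable f →
      ∫⁻ m, expNeg (∫⁻ x, f x ∂m) ∂(κ' t) = (∫⁻ m, expNeg (∫⁻ x, f x ∂m) ∂(κ t)) *
        ∫⁻ s, expNeg (f (y t) * ENNReal.ofReal s) ∂(K t) := by
  let F : T × (Measure X × ℝ) → Measure X :=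
    fun q => addAtoms (fun _ : Unit => y q.1) (q.2.1, fun _ => q.2.2)
  have hFint : ∀ q, ∀ f : X → ℝ≥0∞, Measurable f →
      ∫⁻ x, f x ∂(F q) = ∫⁻ x, f x ∂q.2.1 + f (y q.1) * ENNReal.ofReal q.2.2 := by
    intro q f hf
    simp [F, lintegral_addAtoms _ _ hf]
  have hF : Measurable F := by
    refine Measure.measurable_of_measurable_coe _ fun A hA => ?_
    have h1 : ∀ q, F q A = ∫⁻ x, A.indicator 1 x ∂q.2.1
        + A.indicator 1 (y q.1) * ENNReal.ofReal q.2.2 := by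
      intro q
      rw [← hFint q _ (measurable_one.indicator hA), lintegral_indicator_one hA]
    simp only [h1]
    have h2 : Measurable (A.indicator (1 : X → ℝ≥0∞)) := measurable_one.indicator hA
    fun_prop
  refine ⟨(Kernel.id ×ₖ (κ ×ₖ K)).map F, Kernel.IsMarkovKernel.map _ hF, fun t f hf => ?_⟩
  rw [Kernel.lintegral_map _ hF _ (by fun_prop), Kernel.lintegral_prod _ _ _
    (by simp only [hFint _ f hf]; fun_prop), Kernel.lintegral_id']
  · simp only [hFint _ f hf, expNeg_add]
    rw [Kernel.lintegral_prod _ _ _ (by fun_prop)]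
    exact lintegral_lintegral_mul (f := fun m => expNeg (∫⁻ x, f x ∂m))
      (g := fun s => expNeg (f (y t) * ENNReal.ofReal s)) (by fun_prop)
      (Measurable.aemeasurable (by fun_prop))
  · simp only [hFint _ f hf]
    fun_prop

/-- Adding finitely many independent atoms to a random measure, as an operation on kernels. -/
lemma exists_kernel_addAtoms {ι : Type*} [Fintype ι] (κ : Kernel T (Measure X)) [IsMarkovKernel κ]
    (K : ι → Kernel T ℝ) [∀ i, IsMarkovKernel (K i)] {y : T → ι → X} (hy : Measurable y) :
    ∃ κ' : Kernel T (Measure X), IsMarkovKernel κ' ∧ ∀ t, ∀ f : X → ℝ≥0∞, Measurable f →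
      ∫⁻ m, expNeg (∫⁻ x, f x ∂m) ∂(κ' t) = (∫⁻ m, expNeg (∫⁻ x, f x ∂m) ∂(κ t)) *
        ∏ i, ∫⁻ s, expNeg (f (y t i) * ENNReal.ofReal s) ∂(K i t) := by
  classical
  suffices H : ∀ F : Finset ι, ∃ κ' : Kernel T (Measure X), IsMarkovKernel κ' ∧
      ∀ t, ∀ f : X → ℝ≥0∞, Measurable f →
      ∫⁻ m, expNeg (∫⁻ x, f x ∂m) ∂(κ' t) = (∫⁻ m, expNeg (∫⁻ x, f x ∂m) ∂(κ t)) *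
        ∏ i ∈ F, ∫⁻ s, expNeg (f (y t i) * ENNReal.ofReal s) ∂(K i t) from H Finset.univ
  intro F
  induction F using Finset.induction_on with
  | empty => exact ⟨κ, inferInstance, fun t f _ => by simp⟩
  | insert i F hi ih =>
    obtain ⟨κ₁, _, h₁⟩ := ih
    obtain ⟨κ₂, hκ₂, h₂⟩ := exists_kernel_addAtom κ₁ (K i) (measurable_pi_iff.1 hy i)
    refine ⟨κ₂, hκ₂, fun t f hf => ?_⟩
    rw [h₂ t f hf, h₁ t f hf, Finset.prod_insert hi]
    ring

end Kernel

section Data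

variable {X : Type*} {n : ℕ}

/-- The index `i` is the first at which the value `x i` occurs. -/
def IsFirst (x : Fin n → X) (i : Fin n) : Prop := ∀ j < i, x j ≠ x i

open scoped Classical in
lemma distinctValues_eq_image (x : Fin n → X) :
    distinctValues x = (Finset.univ.filter (IsFirst x)).image x := by
  ext y
  simp only [distinctValues, Finset.mem_image, Finset.mem_univ, true_and, Finset.mem_filter]
  constructor
  · rintro ⟨i, rfl⟩
    have hne : (Finset.univ.filter fun j => x j = x i).Nonempty := ⟨i, by simp⟩
    obtain ⟨j, hj, hmin⟩ := Finset.exists_minimal hne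
    simp only [Finset.mem_filter, Finset.mem_univ, true_and] at hj hmin
    refine ⟨j, fun k hk hkj => ?_, hj⟩
    exact absurd (hmin (hkj.trans hj) hk.le) (not_le.2 hk)
  · rintro ⟨i, -, rfl⟩
    exact ⟨i, rfl⟩

lemma injOn_isFirst (x : Fin n → X) : InjOn x {i | IsFirst x i} := by
  intro i hi j hj hij
  rcases lt_trichotomy i j with h | h | h
  · exact absurd hij (hj i h)
  · exact h
  · exact absurd hij.symm (hi j h)

open scoped Classical in
lemma prod_distinctValues {M : Type*} [CommMonoid M] (x : Fin n → X) (φ : X → M) :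
    ∏ y ∈ distinctValues x, φ y = ∏ i, if IsFirst x i then φ (x i) else 1 := by
  rw [distinctValues_eq_image, Finset.prod_image, Finset.prod_filter]
  simpa using injOn_isFirst x

open scoped Classical in
lemma sum_distinctValues {M : Type*} [AddCommMonoid M] (x : Fin n → X) (φ : X → M) :
    ∑ y ∈ distinctValues x, φ y = ∑ i, if IsFirst x i then φ (x i) else 0 := by
  rw [distinctValues_eq_image, Finset.sum_image, Finset.sum_filter]
  simpa using injOn_isFirst x

lemma mem_distinctValues {x : Fin n → X} {y : X} : y ∈ distinctValues x ↔ ∃ i, x i = y := by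
  simp [distinctValues]

open scoped Classical in
lemma clusterSize_eq_sum (x : Fin n → X) (y : X) :
    clusterSize x y = ∑ i, if x i = y then 1 else 0 := by
  rw [clusterSize, Finset.card_filter]

lemma clusterSize_ne_zero {x : Fin n → X} {y : X} (h : y ∈ distinctValues x) :
    clusterSize x y ≠ 0 := by
  classical
  obtain ⟨i, hi⟩ := mem_distinctValues.1 h
  rw [clusterSize, Finset.card_ne_zero]
  exact ⟨i, by simpa using hi⟩

lemma clusterSize_eq_zero {x : Fin n → X} {y : X} (h : y ∉ distinctValues x) :
    clusterSize x y = 0 := by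
  classical
  rw [clusterSize, Finset.card_eq_zero, Finset.filter_eq_empty_iff]
  exact fun i _ hi => h (mem_distinctValues.2 ⟨i, hi⟩)

open scoped Classical in
lemma clusterSize_cons (y z : X) (x : Fin n → X) :
    clusterSize (Fin.cons y x : Fin (n + 1) → X) z = clusterSize x z + if z = y then 1 else 0 := by
  rw [clusterSize_eq_sum, clusterSize_eq_sum, Fin.sum_univ_succ, add_comm]
  simp [eq_comm]

open scoped Classical in
lemma distinctValues_cons (y : X) (x : Fin n → X) :
    distinctValues (Fin.cons y x : Fin (n + 1) → X) = insert y (distinctValues x) := by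
  ext z
  rw [Finset.mem_insert, mem_distinctValues, mem_distinctValues, Fin.exists_fin_succ]
  simp [eq_comm]

variable [MeasurableSpace X] [MeasurableEq X]

lemma measurableSet_isFirst (i : Fin n) : MeasurableSet {x : Fin n → X | IsFirst x i} := by
  have : {x : Fin n → X | IsFirst x i} = ⋂ j, ⋂ (_ : j < i), {x | x j = x i}ᶜ := by
    ext x; simp [IsFirst]
  rw [this]
  exact MeasurableSet.iInter fun j => MeasurableSet.iInter fun _ =>
    (measurableSet_eq_fun (measurable_pi_apply j) (measurable_pi_apply i)).compl

lemma measurable_clusterSize_apply (i : Fin n) :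
    Measurable fun x : Fin n → X => clusterSize x (x i) := by
  classical
  simp only [clusterSize_eq_sum]
  exact Finset.measurable_sum _ fun j _ => Measurable.ite
    (measurableSet_eq_fun (measurable_pi_apply j) (measurable_pi_apply i)) measurable_const
    measurable_const

end Data

section Weight

variable {X T : Type*} [MeasurableSpace X] [MeasurableSpace T] {ρ : Kernel X ℝ}

lemma measurable_momentDensity {m : T → ℕ} {a : T → ℝ} (hm : Measurable m) (ha : Measurable a) :
    Measurable fun q : T × ℝ => ENNReal.ofReal (q.2 ^ m q.1 * Real.exp (-(q.2 * a q.1))) := by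
  have h : Measurable fun q : T × ℝ => q.2 ^ m q.1 :=
    measurable_snd.pow (hm.comp measurable_fst)
  fun_prop

lemma measurable_tau [IsSFiniteKernel ρ] {m : T → ℕ} {y : T → X} {a : T → ℝ} (hm : Measurable m) (hy : Measurable y)
    (ha : Measurable a) : Measurable fun t => tau ρ (m t) (y t) (a t) :=
  (measurable_momentDensity hm ha).lintegral_kernel_prod_right' (κ := ρ.comap y hy)

/-- The weight `∏_k τ_{n_k, Y_k}(a)` of the data `x`. -/
def sampleWeight (ρ : Kernel X ℝ) (a : ℝ) {n : ℕ} (x : Fin n → X) : ℝ≥0∞ :=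
  ∏ y ∈ distinctValues x, tau ρ (clusterSize x y) y a

lemma measurable_sampleWeight [IsSFiniteKernel ρ] [MeasurableEq X] {n : ℕ} {a : T → ℝ} {x : T → Fin n → X}
    (ha : Measurable a) (hx : Measurable x) : Measurable fun t => sampleWeight ρ (a t) (x t) := by
  classical
  simp only [sampleWeight, prod_distinctValues]
  refine Finset.measurable_prod _ fun i _ => Measurable.ite (hx (measurableSet_isFirst i)) ?_
    measurable_const
  exact measurable_tau ((measurable_clusterSize_apply i).comp hx)
    ((measurable_pi_apply i).comp hx) ha

lemma isProbabilityMeasure_jumpLaw {m : ℕ} {z : X} {a : ℝ} (h0 : 0 < tau ρ m z a)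
    (h1 : tau ρ m z a < ∞) : IsProbabilityMeasure (jumpLaw ρ m z a) := by
  constructor
  rw [jumpLaw, Measure.smul_apply, withDensity_apply _ MeasurableSet.univ, Measure.restrict_univ,
    smul_eq_mul]
  exact ENNReal.inv_mul_cancel h0.ne' h1.ne

lemma lintegral_jumpLaw (hρ : ∀ x, ρ x (Iic 0) = 0) {m : ℕ} {z : X} {a : ℝ} (ha : 0 ≤ a)
    (h0 : 0 < tau ρ m z a) (h1 : tau ρ m z a < ∞) {g : ℝ → ℝ≥0∞} (hg : Measurable g) :
    tau ρ m z a * ∫⁻ s, g s ∂(jumpLaw ρ m z a) =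
      ∫⁻ s, ENNReal.ofReal s ^ m * expNeg (ENNReal.ofReal a * ENNReal.ofReal s) * g s ∂(ρ z) := by
  rw [jumpLaw_eq hρ m z ha, lintegral_smul_measure, ← tau_eq_expMoment hρ m z ha,
    lintegral_withDensity_mul _ (by fun_prop) hg, smul_eq_mul, ← mul_assoc,
    ENNReal.mul_inv_cancel h0.ne' h1.ne, one_mul]

lemma tau_mul_laplace_jumpLaw (hρ : ∀ x, ρ x (Iic 0) = 0) {m : ℕ} {z : X} {a : ℝ} (ha : 0 ≤ a)
    (h0 : 0 < tau ρ m z a) (h1 : tau ρ m z a < ∞) (j : ℕ) (c : ℝ≥0∞) :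
    tau ρ m z a * ∫⁻ s, ENNReal.ofReal s ^ j * expNeg (c * ENNReal.ofReal s) ∂(jumpLaw ρ m z a) =
      expMoment ρ (m + j) z (ENNReal.ofReal a + c) := by
  rw [lintegral_jumpLaw hρ ha h0 h1 (by fun_prop)]
  refine lintegral_congr fun s => ?_
  rw [add_mul, expNeg_add, pow_add]
  ring

lemma measurable_crmExponent_ofReal {ν : Measure (X × ℝ)} [SFinite ν] :
    Measurable fun a : ℝ => crmExponent ν fun _ => ENNReal.ofReal a := by
  have h : Measurable fun q : ℝ × (X × ℝ) =>
      1 - expNeg (ENNReal.ofReal q.1 * ENNReal.ofReal q.2.2) := by fun_prop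
  exact h.lintegral_prod_right'

lemma exists_kernel_expTilt {L : Measure (Measure X)} {ν : Measure (X × ℝ)} [SigmaFinite ν]
    (hL : IsCRMLaw L ν) (hfin : ∀ a : ℝ, crmExponent ν (fun _ => ENNReal.ofReal a) ≠ ∞) :
    ∃ κ : Kernel ℝ (Measure X), IsMarkovKernel κ ∧
      ∀ a, κ a = expTilt L ν (ENNReal.ofReal a) := by
  have := hL.isProbabilityMeasure
  have hd : Measurable (Function.uncurry fun (a : ℝ) (m : Measure X) =>
      (expNeg (crmExponent ν fun _ => ENNReal.ofReal a))⁻¹ *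
        expNeg (ENNReal.ofReal a * m univ)) := by
    have h1 : Measurable fun a : ℝ => expNeg (crmExponent ν fun _ => ENNReal.ofReal a) :=
      measurable_expNeg.comp measurable_crmExponent_ofReal
    have h2 : Measurable fun q : ℝ × Measure X => q.2 univ :=
      (Measure.measurable_coe MeasurableSet.univ).comp measurable_snd
    have h3 : Measurable fun q : ℝ × Measure X => expNeg (ENNReal.ofReal q.1 * q.2 univ) := by
      fun_prop
    exact (h1.inv.comp measurable_fst).mul h3
  have hK : ∀ a, Kernel.withDensity (Kernel.const ℝ L) (fun a m =>
      (expNeg (crmExponent ν fun _ => ENNReal.ofReal a))⁻¹ * expNeg (ENNReal.ofReal a * m univ)) a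
      = expTilt L ν (ENNReal.ofReal a) := by
    intro a
    rw [Kernel.withDensity_apply _ hd]
    rfl
  refine ⟨_, ⟨fun a => ?_⟩, hK⟩
  rw [hK]
  exact (hL.expTilt (hfin a)).isProbabilityMeasure

end Weight

section PosteriorKernel

variable {X : Type*} [MeasurableSpace X] [MeasurableEq X] {ρ : Kernel X ℝ} [IsSFiniteKernel ρ]
  {n : ℕ}

open scoped Classical in
/-- The kernel of jump laws, trivial at repeated indices and at degenerate data. -/
lemma exists_kernel_jumpLaw (ρ : Kernel X ℝ) [IsSFiniteKernel ρ] (i : Fin n) :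
    ∃ K : Kernel (ℝ × (Fin n → X)) ℝ, IsMarkovKernel K ∧ ∀ t, K t =
      if IsFirst t.2 i ∧ 0 < tau ρ (clusterSize t.2 (t.2 i)) (t.2 i) t.1 ∧
        tau ρ (clusterSize t.2 (t.2 i)) (t.2 i) t.1 < ∞
      then jumpLaw ρ (clusterSize t.2 (t.2 i)) (t.2 i) t.1 else Measure.dirac 0 := by
  have hy : Measurable fun t : ℝ × (Fin n → X) => t.2 i := by fun_prop
  have hm : Measurable fun t : ℝ × (Fin n → X) => clusterSize t.2 (t.2 i) :=
    (measurable_clusterSize_apply i).comp measurable_snd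
  have hτ : Measurable fun t : ℝ × (Fin n → X) => tau ρ (clusterSize t.2 (t.2 i)) (t.2 i) t.1 :=
    measurable_tau hm hy measurable_fst
  have hd : Measurable (Function.uncurry fun (t : ℝ × (Fin n → X)) (s : ℝ) =>
      (tau ρ (clusterSize t.2 (t.2 i)) (t.2 i) t.1)⁻¹ *
        ENNReal.ofReal (s ^ clusterSize t.2 (t.2 i) * Real.exp (-(s * t.1)))) :=
    (hτ.inv.comp measurable_fst).mul (measurable_momentDensity hm measurable_fst)
  let S : Set (ℝ × (Fin n → X)) := {t | IsFirst t.2 i ∧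
    0 < tau ρ (clusterSize t.2 (t.2 i)) (t.2 i) t.1 ∧
    tau ρ (clusterSize t.2 (t.2 i)) (t.2 i) t.1 < ∞}
  have hS : MeasurableSet S := (measurable_snd (measurableSet_isFirst i)).inter
    ((measurableSet_lt measurable_const hτ).inter (measurableSet_lt hτ measurable_const))
  let K := Kernel.piecewise hS (Kernel.withDensity (ρ.comap _ hy) fun t s =>
      (tau ρ (clusterSize t.2 (t.2 i)) (t.2 i) t.1)⁻¹ *
        ENNReal.ofReal (s ^ clusterSize t.2 (t.2 i) * Real.exp (-(s * t.1))))
      (Kernel.const _ (Measure.dirac 0))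
  have hK : ∀ t, K t = if IsFirst t.2 i ∧ 0 < tau ρ (clusterSize t.2 (t.2 i)) (t.2 i) t.1 ∧
        tau ρ (clusterSize t.2 (t.2 i)) (t.2 i) t.1 < ∞
      then jumpLaw ρ (clusterSize t.2 (t.2 i)) (t.2 i) t.1 else Measure.dirac 0 := by
    intro t
    rw [Kernel.piecewise_apply]
    refine if_congr Iff.rfl ?_ rfl
    rw [Kernel.withDensity_apply _ hd, Kernel.comap_apply, jumpLaw,
      ← withDensity_smul _ (by fun_prop)]
    rfl
  refine ⟨K, ⟨fun t => ?_⟩, hK⟩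
  rw [hK]
  split_ifs with h
  · exact isProbabilityMeasure_jumpLaw h.2.1 h.2.2
  · infer_instance

/-- The data `x` is regular at `a` if all the moments `τ_{n_k, Y_k}(a)` are positive and finite. -/
def IsRegular (ρ : Kernel X ℝ) (a : ℝ) (x : Fin n → X) : Prop :=
  ∀ y ∈ distinctValues x, 0 < tau ρ (clusterSize x y) y a ∧ tau ρ (clusterSize x y) y a < ∞

/-- The posterior law of the random measure given the data `x`. -/
def posteriorLaw (L : Measure (Measure X)) (ν : Measure (X × ℝ)) (ρ : Kernel X ℝ) (a : ℝ)
    (x : Fin n → X) : Measure (Measure X) :=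
  ((expTilt L ν (ENNReal.ofReal a)).prod (Measure.pi
    fun y : distinctValues x => jumpLaw ρ (clusterSize x y.1) y.1 a)).map
      (addAtoms fun y : distinctValues x => y.1)

/-- The posterior laws form a kernel. -/
lemma exists_posteriorKernel {L : Measure (Measure X)} {ν : Measure (X × ℝ)} [SigmaFinite ν]
    (hL : IsCRMLaw L ν) (hfin : ∀ a : ℝ, crmExponent ν (fun _ => ENNReal.ofReal a) ≠ ∞)
    (ρ : Kernel X ℝ) [IsSFiniteKernel ρ] (n : ℕ) :
    ∃ κ : Kernel (ℝ × (Fin n → X)) (Measure X), IsMarkovKernel κ ∧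
      ∀ a x, IsRegular ρ a x → κ (a, x) = posteriorLaw L ν ρ a x := by
  classical
  obtain ⟨κ₀, _, hκ₀⟩ := exists_kernel_expTilt hL hfin
  choose K hKm hK using fun i : Fin n => exists_kernel_jumpLaw ρ i
  obtain ⟨κ, hκ, hlap⟩ := exists_kernel_addAtoms (κ₀.comap Prod.fst measurable_fst) K
    (y := fun t : ℝ × (Fin n → X) => t.2) measurable_snd
  refine ⟨κ, hκ, fun a x hx => ?_⟩
  have := (hL.expTilt (hfin a)).isProbabilityMeasure
  have : ∀ y : distinctValues x, IsProbabilityMeasure (jumpLaw ρ (clusterSize x y.1) y.1 a) :=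
    fun y => isProbabilityMeasure_jumpLaw (hx y.1 y.2).1 (hx y.1 y.2).2
  have : IsProbabilityMeasure (posteriorLaw L ν ρ a x) := isProbabilityMeasure_map_addAtoms _
  refine measure_ext_of_laplace fun f hf => ?_
  rw [hlap _ f hf, posteriorLaw, laplace_map_addAtoms _ hf, Kernel.comap_apply, hκ₀]
  congr 1
  rw [Finset.prod_coe_sort (distinctValues x) fun y =>
    ∫⁻ s, expNeg (f y * ENNReal.ofReal s) ∂(jumpLaw ρ (clusterSize x y) y a), prod_distinctValues]
  refine Finset.prod_congr rfl fun i _ => ?_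
  rw [hK]
  have hi := hx (x i) (mem_distinctValues.2 ⟨i, rfl⟩)
  by_cases h : IsFirst x i
  · rw [if_pos ⟨h, hi⟩, if_pos h]
  · rw [if_neg fun h' => h h'.1, if_neg h, lintegral_dirac' _ (by fun_prop)]
    simp

end PosteriorKernel

section Posterior

variable {X : Type*} [MeasurableSpace X] {η : Measure X} {ρ : Kernel X ℝ} {n : ℕ} {L : Measure (Measure X)}

lemma eq_zero_of_tau_eq_zero (hρ : ∀ x, ρ x (Iic 0) = 0) {m : ℕ} {z : X} {a : ℝ}
    (h : tau ρ m z a = 0) : ρ z = 0 := by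
  rw [tau, lintegral_eq_zero_iff (by fun_prop)] at h
  rw [← ae_eq_bot]
  refine Filter.eventually_false_iff_eq_bot.1 ?_
  filter_upwards [h, ae_pos_of_Iic (hρ z)] with s hs hpos
  have : 0 < s ^ m * Real.exp (-(s * a)) := by positivity
  simp only [Pi.zero_apply, ENNReal.ofReal_eq_zero] at hs
  linarith

lemma tau_lt_top_of_mem (hρ : ∀ x, ρ x (Iic 0) = 0) {a : ℝ} (ha : 0 < a) {x : Fin n → X}
    (hx : ∀ i, x i ∈ finiteFibre ρ) {y : X} (hy : y ∈ distinctValues x) :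
    tau ρ (clusterSize x y) y a < ∞ := by
  rw [tau_eq_expMoment hρ _ _ ha.le]
  obtain ⟨i, rfl⟩ := mem_distinctValues.1 hy
  exact expMoment_lt_top hρ (hx i) (clusterSize_ne_zero hy) ha

lemma exists_fibre_eq_zero (hρ : ∀ x, ρ x (Iic 0) = 0) {a : ℝ} (ha : 0 < a) {x : Fin n → X}
    (hx : ∀ i, x i ∈ finiteFibre ρ) (h : ¬ IsRegular ρ a x) :
    ∃ y ∈ distinctValues x, ρ y = 0 := by
  simp only [IsRegular] at h
  push Not at h
  obtain ⟨y, hy, hy'⟩ := h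
  refine ⟨y, hy, ?_⟩
  by_contra h0
  have hpos : 0 < tau ρ (clusterSize x y) y a :=
    pos_iff_ne_zero.2 fun h1 => h0 (eq_zero_of_tau_eq_zero hρ h1)
  exact (hy' hpos).not_gt (tau_lt_top_of_mem hρ ha hx hy)

lemma expMoment_of_fibre_eq_zero {m : ℕ} {z : X} {c : ℝ≥0∞} (h : ρ z = 0) :
    expMoment ρ m z c = 0 := by
  simp [expMoment, h]

lemma sampleWeight_of_fibre_eq_zero {a : ℝ} {x : Fin n → X}
    {y : X} (hy : y ∈ distinctValues x) (h : ρ y = 0) : sampleWeight ρ a x = 0 :=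
  Finset.prod_eq_zero hy (by simp [tau, h])

instance sigmaFinite_withDensity_expNeg {Z : Type*} [MeasurableSpace Z] {ν : Measure Z}
    [SigmaFinite ν] {g : Z → ℝ≥0∞} : SigmaFinite (ν.withDensity fun p => expNeg (g p)) :=
  SigmaFinite.withDensity_of_ne_top (ae_of_all _ fun _ => expNeg_ne_top _)

lemma weight_mul_laplace_posterior {ν : Measure (X × ℝ)} [SigmaFinite ν] (hL : IsCRMLaw L ν)
    (hρ : ∀ x, ρ x (Iic 0) = 0)
    {a : ℝ} (ha : 0 < a) (hfin : crmExponent ν (fun _ => ENNReal.ofReal a) ≠ ∞)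
    {x : Fin n → X} (hx : ∀ i, x i ∈ finiteFibre ρ) {M : Measure (Measure X)}
    (hM : IsRegular ρ a x → M = posteriorLaw L ν ρ a x) {f : X → ℝ≥0∞} (hf : Measurable f) :
    sampleWeight ρ a x * ∫⁻ m, expNeg (∫⁻ z, f z ∂m) ∂M =
      (∫⁻ m, expNeg (∫⁻ z, f z ∂m) ∂(expTilt L ν (ENNReal.ofReal a))) *
        ∏ y ∈ distinctValues x, expMoment ρ (clusterSize x y) y (ENNReal.ofReal a + f y) := by
  by_cases hreg : IsRegular ρ a x
  · have := (hL.expTilt hfin).isProbabilityMeasure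
    have : ∀ y : distinctValues x, IsProbabilityMeasure (jumpLaw ρ (clusterSize x y.1) y.1 a) :=
      fun y => isProbabilityMeasure_jumpLaw (hreg y.1 y.2).1 (hreg y.1 y.2).2
    rw [hM hreg, posteriorLaw, laplace_map_addAtoms _ hf,
      Finset.prod_coe_sort (distinctValues x) fun y =>
        ∫⁻ s, expNeg (f y * ENNReal.ofReal s) ∂(jumpLaw ρ (clusterSize x y) y a),
      mul_left_comm, sampleWeight, ← Finset.prod_mul_distrib]
    congr 1
    refine Finset.prod_congr rfl fun y hy => ?_
    simpa using tau_mul_laplace_jumpLaw hρ ha.le (hreg y hy).1 (hreg y hy).2 0 (f y)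
  · obtain ⟨y, hy, h0⟩ := exists_fibre_eq_zero hρ ha hx hreg
    rw [sampleWeight_of_fibre_eq_zero hy h0,
      Finset.prod_eq_zero hy (expMoment_of_fibre_eq_zero h0)]
    simp

open scoped Classical in
lemma weight_mul_palm_posterior {ν : Measure (X × ℝ)} [SigmaFinite ν] (hL : IsCRMLaw L ν)
    (hρ : ∀ x, ρ x (Iic 0) = 0)
    {a : ℝ} (ha : 0 < a) (hfin : crmExponent ν (fun _ => ENNReal.ofReal a) ≠ ∞)
    {x : Fin n → X} (hx : ∀ i, x i ∈ finiteFibre ρ) {M : Measure (Measure X)}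
    (hM : IsRegular ρ a x → M = posteriorLaw L ν ρ a x) {f h : X → ℝ≥0∞} (hf : Measurable f)
    (hh : Measurable h) :
    sampleWeight ρ a x * ∫⁻ m, (∫⁻ z, h z ∂m) * expNeg (∫⁻ z, f z ∂m) ∂M =
      (∫⁻ m, (∫⁻ z, h z ∂m) * expNeg (∫⁻ z, f z ∂m) ∂(expTilt L ν (ENNReal.ofReal a))) *
        (∏ y ∈ distinctValues x, expMoment ρ (clusterSize x y) y (ENNReal.ofReal a + f y)) +
      (∫⁻ m, expNeg (∫⁻ z, f z ∂m) ∂(expTilt L ν (ENNReal.ofReal a))) *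
        ∑ w ∈ distinctValues x, h w * ∏ y ∈ distinctValues x,
          expMoment ρ (clusterSize x y + if y = w then 1 else 0) y (ENNReal.ofReal a + f y) := by
  by_cases hreg : IsRegular ρ a x
  · have := (hL.expTilt hfin).isProbabilityMeasure
    have : ∀ y : distinctValues x, IsProbabilityMeasure (jumpLaw ρ (clusterSize x y.1) y.1 a) :=
      fun y => isProbabilityMeasure_jumpLaw (hreg y.1 y.2).1 (hreg y.1 y.2).2
    rw [hM hreg, posteriorLaw, palm_laplace_map_addAtoms _ hf hh]
    simp only [Subtype.ext_iff]
    rw [Finset.prod_coe_sort (distinctValues x) fun y =>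
        ∫⁻ s, expNeg (f y * ENNReal.ofReal s) ∂(jumpLaw ρ (clusterSize x y) y a),
      Finset.sum_coe_sort (distinctValues x) fun w => h w * ∏ i : distinctValues x,
        ∫⁻ s, (if i.1 = w then ENNReal.ofReal s else 1) *
          expNeg (f i.1 * ENNReal.ofReal s) ∂(jumpLaw ρ (clusterSize x i.1) i.1 a),
      mul_add, mul_left_comm, sampleWeight, ← Finset.prod_mul_distrib, mul_left_comm,
      Finset.mul_sum]
    congr 2
    · refine Finset.prod_congr rfl fun y hy => ?_
      simpa using tau_mul_laplace_jumpLaw hρ ha.le (hreg y hy).1 (hreg y hy).2 0 (f y)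
    · refine Finset.sum_congr rfl fun w _ => ?_
      rw [Finset.prod_coe_sort (distinctValues x) fun y =>
        ∫⁻ s, (if y = w then ENNReal.ofReal s else 1) *
          expNeg (f y * ENNReal.ofReal s) ∂(jumpLaw ρ (clusterSize x y) y a), mul_left_comm,
        ← Finset.prod_mul_distrib]
      congr 1
      refine Finset.prod_congr rfl fun y hy => ?_
      have key := fun j => tau_mul_laplace_jumpLaw hρ ha.le (hreg y hy).1 (hreg y hy).2 j (f y)
      split_ifs
      · simpa using key 1
      · simpa using key 0
  · obtain ⟨y, hy, h0⟩ := exists_fibre_eq_zero hρ ha hx hreg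
    rw [sampleWeight_of_fibre_eq_zero hy h0,
      Finset.prod_eq_zero hy (expMoment_of_fibre_eq_zero h0),
      Finset.sum_eq_zero fun w _ => by
        rw [Finset.prod_eq_zero hy (expMoment_of_fibre_eq_zero h0), mul_zero]]
    simp

variable [SFinite η] [IsSFiniteKernel ρ]

/-- The Palm formula for the tilted completely random measure. -/
lemma palm_laplace_expTilt [SigmaFinite (η ⊗ₘ ρ)] (hL : IsCRMLaw L (η ⊗ₘ ρ)) {a : ℝ}
    (hfin : crmExponent (η ⊗ₘ ρ) (fun _ => ENNReal.ofReal a) ≠ ∞) {f h : X → ℝ≥0∞}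
    (hf : Measurable f) (hh : Measurable h) :
    ∫⁻ m, (∫⁻ z, h z ∂m) * expNeg (∫⁻ z, f z ∂m) ∂(expTilt L (η ⊗ₘ ρ) (ENNReal.ofReal a)) =
      (∫⁻ m, expNeg (∫⁻ z, f z ∂m) ∂(expTilt L (η ⊗ₘ ρ) (ENNReal.ofReal a))) *
        ∫⁻ z, h z * expMoment ρ 1 z (ENNReal.ofReal a + f z) ∂η := by
  have hLa := hL.expTilt hfin
  rw [hLa.palm_laplace hf hh, hLa.laplace hf,
    lintegral_withDensity_mul _ (by fun_prop) (by fun_prop),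
    Measure.lintegral_compProd (by fun_prop)]
  congr 1
  refine lintegral_congr fun z => ?_
  rw [expMoment, ← lintegral_const_mul _ (by fun_prop)]
  refine lintegral_congr fun s => ?_
  rw [add_mul, expNeg_add]
  ring

lemma lintegral_univ_expTilt_ne_top [SigmaFinite (η ⊗ₘ ρ)] (hL : IsCRMLaw L (η ⊗ₘ ρ))
    (hρ : ∀ x, ρ x (Iic 0) = 0)
    (hfin : ∀ a : ℝ, crmExponent (η ⊗ₘ ρ) (fun _ => ENNReal.ofReal a) ≠ ∞) {a : ℝ}
    (ha : 0 < a) : ∫⁻ m, m univ ∂(expTilt L (η ⊗ₘ ρ) (ENNReal.ofReal a)) ≠ ∞ := by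
  have hLa := hL.expTilt (hfin a)
  have h1 := hLa.palm_laplace (f := fun _ => 0) (h := fun _ => 1) measurable_const measurable_const
  simp only [lintegral_const, one_mul, zero_mul, expNeg_zero, mul_one] at h1
  rw [h1, lintegral_withDensity_mul _ (by fun_prop) (by fun_prop)]
  refine ENNReal.mul_ne_top (expNeg_ne_top _) ?_
  have h2 := lintegral_mul_expNeg_intensity_ne_top hρ (by simpa using hfin 1) ha
  simpa only [mul_comm] using h2

end Posterior

section SampleMeasure

variable {X : Type*} [MeasurableSpace X]

/-- The measure on `X^n` that charges each pattern of ties among the data, the distinct values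
being distributed according to `η`. -/
def sampleMeasure (η : Measure X) : (n : ℕ) → Measure (Fin n → X)
  | 0 => Measure.dirac fun i => i.elim0
  | n + 1 => (η.prod (sampleMeasure η n)).map (fun p => Fin.cons p.1 p.2) +
      ∑ i : Fin n, ((sampleMeasure η n).restrict {x | IsFirst x i}).map fun x => Fin.cons (x i) x

lemma measurable_cons {T : Type*} [MeasurableSpace T] {n : ℕ} {y : T → X} {x : T → Fin n → X}
    (hy : Measurable y) (hx : Measurable x) :
    Measurable fun t => (Fin.cons (y t) (x t) : Fin (n + 1) → X) := by
  refine measurable_pi_iff.2 fun i => ?_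
  refine Fin.cases ?_ (fun j => ?_) i
  · simpa using hy
  · simpa using measurable_pi_iff.1 hx j

instance isFiniteMeasure_sampleMeasure (η : Measure X) [IsFiniteMeasure η] (n : ℕ) :
    IsFiniteMeasure (sampleMeasure η n) := by
  induction n with
  | zero => unfold sampleMeasure; infer_instance
  | succ n ih => unfold sampleMeasure; infer_instance

variable [MeasurableEq X] (η : Measure X) [IsFiniteMeasure η]

open scoped Classical in
lemma lintegral_sampleMeasure_succ (n : ℕ) {F : (Fin (n + 1) → X) → ℝ≥0∞} (hF : Measurable F) :
    ∫⁻ x, F x ∂(sampleMeasure η (n + 1)) =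
      ∫⁻ x, (∫⁻ y, F (Fin.cons y x) ∂η +
        ∑ y ∈ distinctValues x, F (Fin.cons y x)) ∂(sampleMeasure η n) := by
  have h1 : ∀ i : Fin n, Measurable fun x : Fin n → X => F (Fin.cons (x i) x) :=
    fun i => hF.comp (measurable_cons (measurable_pi_apply i) measurable_id)
  have h2 : Measurable fun p : X × (Fin n → X) => F (Fin.cons p.1 p.2) :=
    hF.comp (measurable_cons measurable_fst measurable_snd)
  simp only [sum_distinctValues]
  rw [lintegral_add_left h2.lintegral_prod_left', lintegral_finsetSum _ fun i _ =>
    Measurable.ite (measurableSet_isFirst i) (h1 i) measurable_const, sampleMeasure,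
    lintegral_add_measure, lintegral_map hF (measurable_cons measurable_fst measurable_snd),
    lintegral_prod_symm' _ h2, lintegral_finsetSum_measure]
  congr 1
  refine Finset.sum_congr rfl fun i _ => ?_
  rw [lintegral_map hF (measurable_cons (measurable_pi_apply i) measurable_id'),
    ← lintegral_indicator (measurableSet_isFirst i)]
  refine lintegral_congr fun x => ?_
  simp only [indicator_apply, mem_ofPred_eq]

lemma ae_sampleMeasure {S : Set X} (hS : MeasurableSet S) (h : ∀ᵐ z ∂η, z ∈ S) (n : ℕ) :
    ∀ᵐ x ∂(sampleMeasure η n), ∀ i, x i ∈ S := by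
  classical
  induction n with
  | zero => exact ae_of_all _ fun x i => i.elim0
  | succ n ih =>
    have hm : ∀ k : ℕ, MeasurableSet {x : Fin k → X | ∀ i, x i ∈ S}ᶜ := fun k => by
      simp only [ofPred_forall]
      exact (MeasurableSet.iInter fun i => measurable_pi_apply i hS).compl
    have h0 : sampleMeasure η (n + 1) {x | ∀ i, x i ∈ S}ᶜ = 0 := by
      rw [← lintegral_indicator_one (hm _),
        lintegral_sampleMeasure_succ η n (measurable_one.indicator (hm _))]
      rw [lintegral_eq_zero_of_ae_eq_zero]
      filter_upwards [ih] with x hx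
      have hcons : ∀ y ∈ S, ({x | ∀ i, x i ∈ S}ᶜ : Set (Fin (n + 1) → X)).indicator
          (1 : (Fin (n + 1) → X) → ℝ≥0∞) (Fin.cons y x) = 0 := by
        intro y hy
        refine indicator_of_notMem (notMem_compl_iff.2 fun i => ?_) _
        refine Fin.cases ?_ (fun j => ?_) i
        · simpa using hy
        · simpa using hx j
      have h3 : ∫⁻ y, ({x | ∀ i, x i ∈ S}ᶜ : Set (Fin (n + 1) → X)).indicator
          (1 : (Fin (n + 1) → X) → ℝ≥0∞) (Fin.cons y x) ∂η = 0 := by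
        rw [lintegral_eq_zero_of_ae_eq_zero]
        filter_upwards [h] with y hy using hcons y hy
      rw [h3, Finset.sum_eq_zero]
      · simp
      · intro y hy
        obtain ⟨i, rfl⟩ := mem_distinctValues.1 hy
        exact hcons _ (hx i)
    exact h0

end SampleMeasure

section MomentFormula

variable {X : Type*} [MeasurableSpace X] [MeasurableEq X] {η : Measure X} [IsProbabilityMeasure η]
  [NullSingletonClass η] {ρ : Kernel X ℝ} [IsSFiniteKernel ρ] {n : ℕ} {L : Measure (Measure X)}
  [SigmaFinite (η ⊗ₘ ρ)]

/-- The one-step Palm formula for the posterior law at fixed data `x`. -/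
lemma weight_mul_lintegral_posterior_succ (hL : IsCRMLaw L (η ⊗ₘ ρ)) (hρ : ∀ x, ρ x (Iic 0) = 0)
    (hfin : ∀ a : ℝ, crmExponent (η ⊗ₘ ρ) (fun _ => ENNReal.ofReal a) ≠ ∞) {a : ℝ} (ha : 0 < a)
    {x : Fin n → X} (hx : ∀ i, x i ∈ finiteFibre ρ) {M : Measure (Measure X)}
    (hM : IsRegular ρ a x → M = posteriorLaw L (η ⊗ₘ ρ) ρ a x) [IsFiniteMeasure M]
    (κ : Kernel (Fin (n + 1) → X) (Measure X)) [IsFiniteKernel κ]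
    (hκ : ∀ x, IsRegular ρ a x → κ x = posteriorLaw L (η ⊗ₘ ρ) ρ a x)
    {B : Set X} (hB : MeasurableSet B) {g : Measure X → ℝ≥0∞} (hg : Measurable g) :
    sampleWeight ρ a x * ∫⁻ m, m B * g m ∂M =
      ∫⁻ y, B.indicator 1 y * (sampleWeight ρ a (Fin.cons y x : Fin (n + 1) → X) *
        ∫⁻ m, g m ∂(κ (Fin.cons y x))) ∂η +
      ∑ y ∈ distinctValues x, B.indicator 1 y *
        (sampleWeight ρ a (Fin.cons y x : Fin (n + 1) → X) * ∫⁻ m, g m ∂(κ (Fin.cons y x))) := by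
  classical
  have hfib : ∀ᵐ z ∂η, z ∈ finiteFibre ρ := ae_mem_finiteFibre (by simpa using hfin 1)
  have hcons : Measurable fun y => (Fin.cons y x : Fin (n + 1) → X) :=
    measurable_cons measurable_id measurable_const
  have hBm : Measurable (B.indicator (1 : X → ℝ≥0∞)) := measurable_one.indicator hB
  have hW : Measurable fun y => sampleWeight ρ a (Fin.cons y x : Fin (n + 1) → X) :=
    measurable_sampleWeight measurable_const hcons
  have hκc : Measurable fun y => κ (Fin.cons y x) := κ.measurable.comp hcons
  have hev : Measurable fun m : Measure X => m B := Measure.measurable_coe hB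
  let A : (X → ℝ≥0∞) → ℝ≥0∞ := fun f =>
    ∫⁻ m, expNeg (∫⁻ z, f z ∂m) ∂(expTilt L (η ⊗ₘ ρ) (ENNReal.ofReal a))
  let M₁ := sampleWeight ρ a x • M.withDensity fun m => m B
  let M₂ := (η.withDensity fun y =>
      B.indicator 1 y * sampleWeight ρ a (Fin.cons y x : Fin (n + 1) → X)).bind
      (fun y => κ (Fin.cons y x)) +
    ∑ y ∈ distinctValues x, (B.indicator 1 y *
      sampleWeight ρ a (Fin.cons y x : Fin (n + 1) → X)) • κ (Fin.cons y x)
  have hM₁ : ∀ g : Measure X → ℝ≥0∞, Measurable g →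
      ∫⁻ m, g m ∂M₁ = sampleWeight ρ a x * ∫⁻ m, m B * g m ∂M := by
    intro g hg
    rw [lintegral_smul_measure, lintegral_withDensity_mul _ hev hg, smul_eq_mul]
  have hM₂ : ∀ g : Measure X → ℝ≥0∞, Measurable g → ∫⁻ m, g m ∂M₂ =
      ∫⁻ y, B.indicator 1 y * (sampleWeight ρ a (Fin.cons y x : Fin (n + 1) → X) *
        ∫⁻ m, g m ∂(κ (Fin.cons y x))) ∂η +
      ∑ y ∈ distinctValues x, B.indicator 1 y *
        (sampleWeight ρ a (Fin.cons y x : Fin (n + 1) → X) *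
          ∫⁻ m, g m ∂(κ (Fin.cons y x))) := by
    intro g hg
    have h1 : Measurable fun y => B.indicator 1 y *
        sampleWeight ρ a (Fin.cons y x : Fin (n + 1) → X) := hBm.mul hW
    have h2 : Measurable fun y => ∫⁻ m, g m ∂(κ (Fin.cons y x)) := hg.lintegral_kernel.comp hcons
    rw [lintegral_add_measure, Measure.lintegral_bind hκc.aemeasurable hg.aemeasurable,
      lintegral_withDensity_mul _ h1 h2,
      lintegral_finsetSum_measure]
    simp only [lintegral_smul_measure, smul_eq_mul, mul_assoc]
  have hWfin : ∀ w ∈ distinctValues x, ∏ y ∈ distinctValues x,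
      expMoment ρ (clusterSize x y + if y = w then 1 else 0) y (ENNReal.ofReal a) ≠ ∞ := by
    intro w _
    refine ENNReal.prod_ne_top fun y hy => ?_
    obtain ⟨i, rfl⟩ := mem_distinctValues.1 hy
    have := clusterSize_ne_zero hy
    exact (expMoment_lt_top hρ (hx i) (by omega) ha).ne
  have hlap₁ : ∀ f : X → ℝ≥0∞, Measurable f → ∫⁻ m, expNeg (∫⁻ z, f z ∂m) ∂M₁ =
      A f * (∫⁻ z, B.indicator 1 z * expMoment ρ 1 z (ENNReal.ofReal a + f z) ∂η) *
        (∏ y ∈ distinctValues x, expMoment ρ (clusterSize x y) y (ENNReal.ofReal a + f y)) +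
      A f * ∑ w ∈ distinctValues x, B.indicator 1 w * ∏ y ∈ distinctValues x,
        expMoment ρ (clusterSize x y + if y = w then 1 else 0) y (ENNReal.ofReal a + f y) := by
    intro f hf
    have h1 := weight_mul_palm_posterior hL hρ ha (hfin a) hx hM hf hBm
    simp only [lintegral_indicator_one hB] at h1
    rw [hM₁ _ (by fun_prop), h1]
    have h2 := palm_laplace_expTilt hL (hfin a) hf hBm
    simp only [lintegral_indicator_one hB] at h2
    rw [h2]
  have hlap₂ : ∀ f : X → ℝ≥0∞, Measurable f → ∫⁻ m, expNeg (∫⁻ z, f z ∂m) ∂M₂ =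
      A f * (∫⁻ z, B.indicator 1 z * expMoment ρ 1 z (ENNReal.ofReal a + f z) ∂η) *
        (∏ y ∈ distinctValues x, expMoment ρ (clusterSize x y) y (ENNReal.ofReal a + f y)) +
      A f * ∑ w ∈ distinctValues x, B.indicator 1 w * ∏ y ∈ distinctValues x,
        expMoment ρ (clusterSize x y + if y = w then 1 else 0) y (ENNReal.ofReal a + f y) := by
    intro f hf
    have key : ∀ y ∈ finiteFibre ρ, sampleWeight ρ a (Fin.cons y x : Fin (n + 1) → X) *
        ∫⁻ m, expNeg (∫⁻ z, f z ∂m) ∂(κ (Fin.cons y x)) = A f *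
        ∏ w ∈ insert y (distinctValues x), expMoment ρ (clusterSize x w + if w = y then 1 else 0) w
          (ENNReal.ofReal a + f w) := by
      intro y hy
      have hxy : ∀ i, (Fin.cons y x : Fin (n + 1) → X) i ∈ finiteFibre ρ := fun i => by
        refine Fin.cases ?_ (fun j => ?_) i
        · simpa using hy
        · simpa using hx j
      rw [weight_mul_laplace_posterior hL hρ ha (hfin a) hxy (hκ _) hf, distinctValues_cons]
      simp only [clusterSize_cons]
      rfl
    rw [hM₂ _ (by fun_prop)]
    congr 1
    · have hmom : Measurable fun z => expMoment ρ 1 z (ENNReal.ofReal a + f z) := by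
        have : Measurable fun q : X × ℝ => ENNReal.ofReal q.2 ^ 1 *
            expNeg ((ENNReal.ofReal a + f q.1) * ENNReal.ofReal q.2) := by fun_prop
        exact this.lintegral_kernel_prod_right'
      have hBmom : Measurable fun z => B.indicator 1 z *
          expMoment ρ 1 z (ENNReal.ofReal a + f z) := hBm.mul hmom
      rw [mul_right_comm, ← lintegral_const_mul _ hBmom]
      refine lintegral_congr_ae ?_
      have hnull : ∀ᵐ z ∂η, z ∉ distinctValues x :=
        measure_eq_zero_iff_ae_notMem.1 ((distinctValues x).finite_toSet.measure_zero η)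
      filter_upwards [hfib, hnull] with y hy hyx
      rw [key y hy, Finset.prod_insert hyx, clusterSize_eq_zero hyx]
      have : ∏ w ∈ distinctValues x, expMoment ρ (clusterSize x w + if w = y then 1 else 0) w
          (ENNReal.ofReal a + f w) = ∏ w ∈ distinctValues x, expMoment ρ (clusterSize x w) w
          (ENNReal.ofReal a + f w) := by
        refine Finset.prod_congr rfl fun w hw => ?_
        rw [if_neg (fun h : w = y => hyx (h ▸ hw)), add_zero]
      rw [this, if_pos rfl, zero_add]
      ring
    · rw [Finset.mul_sum]
      refine Finset.sum_congr rfl fun y hy => ?_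
      obtain ⟨i, rfl⟩ := mem_distinctValues.1 hy
      rw [key _ (hx i), Finset.insert_eq_of_mem hy]
      ring
  have hfin₁ : IsFiniteMeasure M₁ := by
    constructor
    have h1 := weight_mul_palm_posterior hL hρ ha (hfin a) hx hM (f := fun _ => 0) (h := B.indicator 1)
      measurable_const hBm
    simp only [lintegral_const, zero_mul, expNeg_zero, mul_one, one_mul,
      lintegral_indicator_one hB, add_zero] at h1
    have h2 := hM₁ (fun _ => 1) measurable_const
    simp only [lintegral_const, one_mul, mul_one] at h2
    have := (hL.expTilt (hfin a)).isProbabilityMeasure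
    rw [h2, h1, measure_univ, one_mul]
    refine ENNReal.add_lt_top.2 ⟨ENNReal.mul_lt_top ?_ ?_, ?_⟩
    · exact (lintegral_mono fun m => measure_mono (subset_univ B)).trans_lt
        (lintegral_univ_expTilt_ne_top hL hρ hfin ha).lt_top
    · refine (ENNReal.prod_ne_top fun y hy => ?_).lt_top
      obtain ⟨i, rfl⟩ := mem_distinctValues.1 hy
      exact (expMoment_lt_top hρ (hx i) (clusterSize_ne_zero hy) ha).ne
    · refine ENNReal.sum_lt_top.2 fun w hw => ENNReal.mul_lt_top ?_ (hWfin w hw).lt_top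
      exact (indicator_le_self' (fun _ _ => zero_le) w).trans_lt ENNReal.one_lt_top
  have hfin₂ : IsFiniteMeasure M₂ := by
    constructor
    have h1 := (hlap₁ (fun _ => 0) measurable_const).trans (hlap₂ _ measurable_const).symm
    simp only [lintegral_const, zero_mul, expNeg_zero, one_mul] at h1
    rw [← h1]
    exact measure_lt_top _ _
  have heq : M₁ = M₂ := measure_ext_of_laplace fun f hf => (hlap₁ f hf).trans (hlap₂ f hf).symm
  rw [← hM₁ g hg, heq, hM₂ g hg]

/-- The joint law of the tilted random measure and of the data, in terms of posterior laws. -/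
theorem lintegral_mul_prod_expTilt (hL : IsCRMLaw L (η ⊗ₘ ρ)) (hρ : ∀ x, ρ x (Iic 0) = 0)
    (hfin : ∀ a : ℝ, crmExponent (η ⊗ₘ ρ) (fun _ => ENNReal.ofReal a) ≠ ∞) {a : ℝ} (ha : 0 < a)
    (n : ℕ) (κ : Kernel (Fin n → X) (Measure X)) [IsFiniteKernel κ]
    (hκ : ∀ x, IsRegular ρ a x → κ x = posteriorLaw L (η ⊗ₘ ρ) ρ a x)
    {g : Measure X → ℝ≥0∞} (hg : Measurable g) {B : Fin n → Set X}
    (hB : ∀ i, MeasurableSet (B i)) :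
    ∫⁻ m, g m * ∏ i, m (B i) ∂(expTilt L (η ⊗ₘ ρ) (ENNReal.ofReal a)) =
      ∫⁻ x, (∏ i, (B i).indicator 1 (x i)) * (sampleWeight ρ a x * ∫⁻ m, g m ∂(κ x))
        ∂(sampleMeasure η n) := by
  induction n generalizing g with
  | zero =>
    have hL0 := (hL.expTilt (hfin a)).isProbabilityMeasure
    have hW : ∀ x : Fin 0 → X, sampleWeight ρ a x = 1 := by
      intro x; simp [sampleWeight, distinctValues]
    have hκ0 : ∀ x : Fin 0 → X, κ x = expTilt L (η ⊗ₘ ρ) (ENNReal.ofReal a) := by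
      intro x
      refine measure_ext_of_laplace fun f hf => ?_
      have h := weight_mul_laplace_posterior hL hρ ha (hfin a) (x := x) (fun i => i.elim0) (hκ x) hf
      simpa [hW, distinctValues] using h
    simp [hW, hκ0, sampleMeasure]
  | succ n ih =>
    obtain ⟨κ₀, _, hκ₀⟩ := exists_posteriorKernel hL hfin ρ n
    let κ₁ : Kernel (Fin n → X) (Measure X) := κ₀.comap (fun x => (a, x)) (by fun_prop)
    have hκ₁ : ∀ x, IsRegular ρ a x → κ₁ x = posteriorLaw L (η ⊗ₘ ρ) ρ a x :=
      fun x hx => by rw [Kernel.comap_apply]; exact hκ₀ a x hx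
    have hev : Measurable fun m : Measure X => m (B 0) := Measure.measurable_coe (hB 0)
    have hBm : ∀ i, Measurable ((B i).indicator (1 : X → ℝ≥0∞)) :=
      fun i => measurable_one.indicator (hB i)
    have hsplit : ∀ m : Measure X, g m * ∏ i, m (B i) = (m (B 0) * g m) * ∏ i : Fin n,
        m (B i.succ) := fun m => by rw [Fin.prod_univ_succ]; ring
    have hevg : Measurable fun m : Measure X => m (B 0) * g m := hev.mul hg
    simp only [hsplit]
    rw [ih κ₁ hκ₁ hevg fun i => hB i.succ, lintegral_sampleMeasure_succ]
    · have hfib : ∀ᵐ z ∂η, z ∈ finiteFibre ρ := ae_mem_finiteFibre (by simpa using hfin 1)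
      refine lintegral_congr_ae ?_
      filter_upwards [ae_sampleMeasure η measurableSet_finiteFibre hfib n] with x hx
      have hcons : Measurable fun y => (Fin.cons y x : Fin (n + 1) → X) :=
        measurable_cons measurable_id measurable_const
      have hF : Measurable fun y => (B 0).indicator (1 : X → ℝ≥0∞) y *
          (sampleWeight ρ a (Fin.cons y x : Fin (n + 1) → X) *
            ∫⁻ m, g m ∂(κ (Fin.cons y x))) :=
        (hBm 0).mul ((measurable_sampleWeight measurable_const hcons).mul
          (hg.lintegral_kernel.comp hcons))
      rw [weight_mul_lintegral_posterior_succ hL hρ hfin ha hx (hκ₁ x) κ hκ (hB 0) hg, mul_add,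
        ← lintegral_const_mul _ hF, Finset.mul_sum]
      simp only [Fin.prod_univ_succ, Fin.cons_zero, Fin.cons_succ]
      congr 1
      · exact lintegral_congr fun y => by ring
      · exact Finset.sum_congr rfl fun y _ => by ring
    · exact (Finset.measurable_prod _ fun i _ => (hBm i).comp (measurable_pi_apply i)).mul
        ((measurable_sampleWeight measurable_const measurable_id).mul hg.lintegral_kernel)

end MomentFormula

section AuxWeight

variable {X : Type*} [MeasurableSpace X] {η : Measure X} [SFinite η] {ρ : Kernel X ℝ}
  [IsSFiniteKernel ρ]

lemma measurable_psi : Measurable fun b : ℝ => psi η ρ 0 b := by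
  have h : ∀ b : ℝ, psi η ρ 0 b = ∫⁻ p, ENNReal.ofReal
      ((1 - Real.exp (-(b * p.2))) * Real.exp (-(0 * p.2))) ∂(η ⊗ₘ ρ) := fun b => by
    rw [Measure.lintegral_compProd (by fun_prop), psi]
  simp only [h]
  have : Measurable fun q : ℝ × (X × ℝ) => ENNReal.ofReal
      ((1 - Real.exp (-(q.1 * q.2.2))) * Real.exp (-(0 * q.2.2))) := by fun_prop
  exact this.lintegral_prod_right'

lemma measurable_auxWeight [MeasurableEq X] (γ q : ℝ) (n : ℕ) :
    Measurable fun p : ℝ × (Fin n → X) => auxWeight η ρ γ q p.2 p.1 := by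
  have h1 : Measurable fun p : ℝ × (Fin n → X) => psi η ρ 0 (γ + p.1) :=
    measurable_psi.comp (measurable_const.add measurable_fst)
  have h2 : Measurable fun p : ℝ × (Fin n → X) => sampleWeight ρ (γ + p.1) p.2 :=
    measurable_sampleWeight (measurable_const.add measurable_fst) measurable_snd
  have h3 : Measurable fun p : ℝ × (Fin n → X) =>
      ENNReal.ofReal (Real.exp (-(psi η ρ 0 (γ + p.1)).toReal)) := by fun_prop
  exact (h3.mul h2).mul (by fun_prop)

lemma auxWeight_eq (hρ : ∀ x, ρ x (Iic 0) = 0) {γ u : ℝ} (hu : 0 ≤ γ + u)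
    (hfin : crmExponent (η ⊗ₘ ρ) (fun _ => ENNReal.ofReal (γ + u)) ≠ ∞) (q : ℝ) {n : ℕ}
    (x : Fin n → X) : auxWeight η ρ γ q x u =
      expNeg (crmExponent (η ⊗ₘ ρ) fun _ => ENNReal.ofReal (γ + u)) * sampleWeight ρ (γ + u) x *
        ENNReal.ofReal (u ^ ((n : ℝ) + q - 1)) := by
  rw [auxWeight, psi_zero_eq_crmExponent hρ hu, ← expNeg_ofReal ENNReal.toReal_nonneg,
    ENNReal.ofReal_toReal hfin]
  rfl

lemma lintegral_expTilt {L : Measure (Measure X)} {ν : Measure (X × ℝ)} {a : ℝ≥0∞}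
    (ha : crmExponent ν (fun _ => a) ≠ ∞) {g : Measure X → ℝ≥0∞} (hg : Measurable g) :
    expNeg (crmExponent ν fun _ => a) * ∫⁻ m, g m ∂(expTilt L ν a) =
      ∫⁻ m, expNeg (a * m univ) * g m ∂L := by
  have h1 := measurable_expNeg_mul_univ (X := X) a
  have h2 : Measurable fun m : Measure X => expNeg (a * m univ) * g m := h1.mul hg
  rw [expTilt, lintegral_withDensity_mul _ (h1.const_mul _) hg]
  simp only [mul_assoc]
  rw [lintegral_const_mul _ h2, ← mul_assoc,
    ENNReal.mul_inv_cancel (fun h => ha (expNeg_eq_zero.1 h)) (expNeg_ne_top _), one_mul]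

lemma measurable_normalizeMeasure : Measurable (normalizeMeasure : Measure X → Measure X) := by
  refine Measure.measurable_of_measurable_coe _ fun A hA => ?_
  simp only [normalizeMeasure, Measure.smul_apply, smul_eq_mul]
  exact (Measure.measurable_coe MeasurableSet.univ).inv.mul (Measure.measurable_coe hA)

lemma measurable_petTilt_univ (γ q : ℝ) :
    Measurable fun m : Measure X => ENNReal.ofReal (petTilt γ q (m univ).toReal) := by
  have h : Measurable fun m : Measure X => m univ := Measure.measurable_coe MeasurableSet.univ
  have h2 : Measurable (petTilt γ q) := by unfold petTilt; fun_prop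
  exact (h2.comp h.ennreal_toReal).ennreal_ofReal

lemma measurable_gammaPDF_uncurry (s : ℝ) :
    Measurable fun p : ℝ × ℝ => gammaPDF s p.1 p.2 := by
  simp only [gammaPDF_eq]
  refine Measurable.ennreal_ofReal (Measurable.ite
    (measurableSet_le measurable_const measurable_snd) (by fun_prop) measurable_const)

lemma gammaMeasure_apply (s r : ℝ) {D : Set ℝ} (hD : MeasurableSet D) :
    gammaMeasure s r D = ∫⁻ u in Ioi 0, D.indicator 1 u * gammaPDF s r u := by
  rw [gammaMeasure, withDensity_apply _ hD, ← lintegral_indicator hD,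
    ← lintegral_indicator measurableSet_Ioi]
  refine lintegral_congr_ae ?_
  filter_upwards [(measure_eq_zero_iff_ae_notMem.1 (by simp : volume ({0} : Set ℝ) = 0))]
    with u hu
  by_cases h : 0 < u
  · rw [indicator_of_mem (show u ∈ Ioi 0 from h)]
    by_cases hD : u ∈ D <;> simp [hD]
  · have hu' : u < 0 := lt_of_le_of_ne (not_lt.1 h) hu
    rw [indicator_of_notMem (show u ∉ Ioi 0 from h)]
    by_cases hD : u ∈ D <;> simp [hD, gammaPDF_of_neg hu']

/-- The pointwise identity that turns the tilt, the normalization and the gamma density into an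
exponential tilt. -/
lemma petTilt_mul_gammaPDF {γ q : ℝ} (hγ : 0 ≤ γ) (n : ℕ) (hs : 0 < (n : ℝ) + q) {T : ℝ≥0∞}
    (hT0 : 0 < T) (hT : T < ∞) {u : ℝ} (hu : 0 < u) :
    ENNReal.ofReal (petTilt γ q T.toReal) * (T⁻¹ ^ n * gammaPDF (n + q) T.toReal u) =
      (ENNReal.ofReal (Real.Gamma (n + q)))⁻¹ * ENNReal.ofReal (u ^ ((n : ℝ) + q - 1)) *
        expNeg (ENNReal.ofReal (γ + u) * T) := by
  have ht : 0 < T.toReal := ENNReal.toReal_pos hT0.ne' hT.ne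
  have hTe : T = ENNReal.ofReal T.toReal := (ENNReal.ofReal_toReal hT.ne).symm
  set t := T.toReal with ht_def
  have hG : 0 < Real.Gamma (n + q) := Real.Gamma_pos_of_pos hs
  have hp : 0 < petTilt γ q t := by unfold petTilt; positivity
  rw [hTe, gammaPDF_of_nonneg hu.le, ← ENNReal.ofReal_mul (by linarith),
    expNeg_ofReal (by positivity), ← ENNReal.ofReal_inv_of_pos ht,
    ← ENNReal.ofReal_inv_of_pos hG, ← ENNReal.ofReal_pow (by positivity),
    ← ENNReal.ofReal_mul (by positivity), ← ENNReal.ofReal_mul hp.le,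
    ← ENNReal.ofReal_mul (by positivity), ← ENNReal.ofReal_mul (by positivity)]
  congr 1
  have h1 : t ^ (-q) * (t⁻¹ ^ n * t ^ ((n : ℝ) + q)) = 1 := by
    rw [Real.rpow_add ht, Real.rpow_natCast, Real.rpow_neg ht.le, inv_pow]
    have : t ^ q ≠ 0 := (Real.rpow_pos_of_pos ht q).ne'
    field_simp
  have h2 : Real.exp (-((γ + u) * t)) = Real.exp (-(γ * t)) * Real.exp (-(t * u)) := by
    rw [← Real.exp_add]; ring_nf
  rw [h2, petTilt]
  calc _ = (t ^ (-q) * (t⁻¹ ^ n * t ^ ((n : ℝ) + q))) * ((Real.Gamma (n + q))⁻¹ *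
        u ^ ((n : ℝ) + q - 1) * (Real.exp (-(γ * t)) * Real.exp (-(t * u)))) := by
        rw [div_eq_mul_inv]; ring
    _ = _ := by rw [h1, one_mul]

end AuxWeight

section JointLaw

variable {Ω X : Type*} [MeasurableSpace Ω] [MeasurableSpace X] {M : Measure (Measure X)} {q : ℝ}
  {n : ℕ} {P : Measure Ω} {μt : Ω → Measure X} {S : Ω → Fin n → X} {U : Ω → ℝ}

lemma IsAugmentedSample.lintegral_likelihood (hS : IsAugmentedSample M q P μt S U)
    {B : Fin n → Set X} (hB : ∀ i, MeasurableSet (B i)) {g : Measure X → ℝ≥0∞}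
    (hg : Measurable g) :
    ∫⁻ ω in {ω | ∀ i, S ω i ∈ B i}, g (μt ω) ∂P =
      ∫⁻ m, (∏ i, normalizeMeasure m (B i)) * g m ∂M := by
  have hw : Measurable fun m : Measure X => ∏ i, normalizeMeasure m (B i) :=
    Finset.measurable_prod _ fun i _ => (Measure.measurable_coe (hB i)).comp
      measurable_normalizeMeasure
  rw [← lintegral_map hg hS.measurable_measure, ← lintegral_withDensity_mul _ hw hg]
  congr 1
  ext A hA
  rw [Measure.map_apply hS.measurable_measure hA, Measure.restrict_apply
    (hS.measurable_measure hA), withDensity_apply _ hA, ← hS.likelihood A B hA hB]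
  rfl

lemma eq_lintegral_of_box {ν : Measure (Fin n → X)} [IsFiniteMeasure ν]
    {Λ : Measure (Fin n → X)} [SFinite Λ] {V : Measure ℝ} [SFinite V]
    {H : ℝ × (Fin n → X) → ℝ≥0∞} (hH : Measurable H)
    (h : ∀ B : Fin n → Set X, (∀ i, MeasurableSet (B i)) → ν (univ.pi B) =
      ∫⁻ u, ∫⁻ x, (∏ i, (B i).indicator 1 (x i)) * H (u, x) ∂Λ ∂V)
    {T : Set (Fin n → X)} (hT : MeasurableSet T) :
    ν T = ∫⁻ u, ∫⁻ x, T.indicator 1 x * H (u, x) ∂Λ ∂V := by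
  set ν' : Measure (Fin n → X) := Λ.withDensity fun x => ∫⁻ u, H (u, x) ∂V with hν'
  have key : ∀ T, MeasurableSet T → ν' T = ∫⁻ u, ∫⁻ x, T.indicator 1 x * H (u, x) ∂Λ ∂V := by
    intro T hT
    have hTi : Measurable (T.indicator (1 : (Fin n → X) → ℝ≥0∞)) := measurable_one.indicator hT
    have h2 : Measurable fun p : ℝ × (Fin n → X) => T.indicator 1 p.2 * H p :=
      (hTi.comp measurable_snd).mul hH
    have h3 := lintegral_lintegral_swap (μ := V) (ν := Λ)
      (f := fun u x => T.indicator 1 x * H (u, x)) h2.aemeasurable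
    rw [h3, hν', withDensity_apply _ hT, ← lintegral_indicator hT]
    refine lintegral_congr fun x => ?_
    have hc : Measurable fun u => H (u, x) := hH.comp measurable_prodMk_right
    rw [lintegral_const_mul _ hc]
    by_cases hx : x ∈ T <;> simp [hx]
  have hbox : ∀ B : Fin n → Set X, (∀ i, MeasurableSet (B i)) →
      ν (univ.pi B) = ν' (univ.pi B) := by
    intro B hB
    rw [h B hB, key _ (MeasurableSet.univ_pi hB)]
    refine lintegral_congr fun u => lintegral_congr fun x => ?_
    congr 1
    by_cases hx : x ∈ univ.pi B
    · rw [indicator_of_mem hx]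
      exact Finset.prod_eq_one fun i _ => indicator_of_mem (hx i trivial) _
    · rw [indicator_of_notMem hx]
      simp only [mem_univ_pi, not_forall] at hx
      obtain ⟨i, hi⟩ := hx
      exact Finset.prod_eq_zero (Finset.mem_univ i) (indicator_of_notMem hi _)
  have hνν' : ν = ν' := by
    refine ext_of_generate_finite _ generateFrom_pi.symm isPiSystem_pi ?_ ?_
    · rintro _ ⟨B, hB, rfl⟩
      exact hbox B fun i => hB i trivial
    · simpa using hbox (fun _ => univ) fun _ => MeasurableSet.univ
  rw [hνν', key T hT]

variable {η : Measure X} [IsProbabilityMeasure η] {ρ : Kernel X ℝ} [IsSFiniteKernel ρ]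
  {L : Measure (Measure X)} {γ : ℝ}

/-- The constant that normalizes the joint law of the data and of the auxiliary variable. -/
def jointConst (L : Measure (Measure X)) (γ q : ℝ) (n : ℕ) : ℝ≥0∞ :=
  (tiltConst (petTilt γ q) L)⁻¹ * (ENNReal.ofReal (Real.Gamma (n + q)))⁻¹

/-- The joint law of the auxiliary variable and of the data. -/
def auxLaw (η : Measure X) (ρ : Kernel X ℝ) (L : Measure (Measure X)) (γ q : ℝ) (n : ℕ) :
    Measure (ℝ × (Fin n → X)) :=
  ((volume.restrict (Ioi 0)).prod (sampleMeasure η n)).withDensity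
    fun p => jointConst L γ q n * auxWeight η ρ γ q p.2 p.1

instance sFinite_auxLaw (n : ℕ) : SFinite (auxLaw η ρ L γ q n) := by
  unfold auxLaw; infer_instance

lemma lintegral_auxLaw [MeasurableEq X] {g : ℝ × (Fin n → X) → ℝ≥0∞} (hg : Measurable g) :
    ∫⁻ p, g p ∂(auxLaw η ρ L γ q n) = ∫⁻ u in Ioi 0, ∫⁻ x,
      jointConst L γ q n * auxWeight η ρ γ q x u * g (u, x) ∂(sampleMeasure η n) := by
  have hw : Measurable fun p : ℝ × (Fin n → X) =>
      jointConst L γ q n * auxWeight η ρ γ q p.2 p.1 := (measurable_auxWeight γ q n).const_mul _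
  have hwg : Measurable fun p : ℝ × (Fin n → X) =>
      jointConst L γ q n * auxWeight η ρ γ q p.2 p.1 * g p := hw.mul hg
  rw [auxLaw, lintegral_withDensity_mul _ hw hg, lintegral_prod _ hwg.aemeasurable]

variable [MeasurableEq X] [NullSingletonClass η] [SigmaFinite (η ⊗ₘ ρ)]

lemma IsAugmentedSample.measure_box
    (hS : IsAugmentedSample (tiltedLaw (petTilt γ q) L) q P μt S U)
    (hL : IsCRMLaw L (η ⊗ₘ ρ)) (hρ : ∀ x, ρ x (Iic 0) = 0)
    (hfin : ∀ a : ℝ, crmExponent (η ⊗ₘ ρ) (fun _ => ENNReal.ofReal a) ≠ ∞)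
    (hT : ∀ᵐ m ∂L, 0 < m univ ∧ m univ < ∞) (hγ : 0 ≤ γ) (hn : 0 < (n : ℝ) + q)
    (κ : Kernel (ℝ × (Fin n → X)) (Measure X)) [IsFiniteKernel κ]
    (hκ : ∀ a x, IsRegular ρ a x → κ (a, x) = posteriorLaw L (η ⊗ₘ ρ) ρ a x)
    {A : Set (Measure X)} (hA : MeasurableSet A) {B : Fin n → Set X}
    (hB : ∀ i, MeasurableSet (B i)) {D : Set ℝ} (hD : MeasurableSet D) :
    P {ω | (U ω ∈ D ∧ ∀ i, S ω i ∈ B i) ∧ μt ω ∈ A} =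
      ∫⁻ u in Ioi 0, D.indicator 1 u * ∫⁻ x, (∏ i, (B i).indicator 1 (x i)) *
        (jointConst L γ q n * auxWeight η ρ γ q x u * κ (γ + u, x) A) ∂(sampleMeasure η n) := by
  have := hL.isProbabilityMeasure
  set E : Set Ω := {ω | ∀ i, S ω i ∈ B i} with hE
  have hAi : Measurable (A.indicator (1 : Measure X → ℝ≥0∞)) := measurable_one.indicator hA
  have hDi : Measurable (D.indicator (1 : ℝ → ℝ≥0∞)) := measurable_one.indicator hD
  have huniv : Measurable fun m : Measure X => m univ := Measure.measurable_coe MeasurableSet.univ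
  have hpdf : Measurable fun p : Measure X × ℝ =>
      D.indicator 1 p.2 * gammaPDF (n + q) (p.1 univ).toReal p.2 := by
    have h1 : Measurable fun p : Measure X × ℝ => ((p.1 univ).toReal, p.2) :=
      (huniv.ennreal_toReal.comp measurable_fst).prodMk measurable_snd
    exact (hDi.comp measurable_snd).mul ((measurable_gammaPDF_uncurry (n + q)).comp h1)
  let G : Measure X → ℝ≥0∞ := fun m => gammaMeasure (n + q) (m univ).toReal D
  have hG : Measurable G := by
    simp only [G, gammaMeasure_apply _ _ hD]
    exact hpdf.lintegral_prod_right'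
  have hAG : Measurable fun m => A.indicator 1 m * G m := hAi.mul hG
  have hprod : Measurable fun m : Measure X => ∏ i, m (B i) :=
    Finset.measurable_prod _ fun i _ => Measure.measurable_coe (hB i)
  have hF : Measurable fun m : Measure X => A.indicator 1 m * ∏ i, m (B i) := hAi.mul hprod
  have hwn : Measurable fun m : Measure X => ∏ i, normalizeMeasure m (B i) :=
    Finset.measurable_prod _ fun i _ => (Measure.measurable_coe (hB i)).comp
      measurable_normalizeMeasure
  have hwAG : Measurable fun m : Measure X =>
      (∏ i, normalizeMeasure m (B i)) * (A.indicator 1 m * G m) := hwn.mul hAG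
  have hpi : MeasurableSet (A ×ˢ univ.pi B) := hA.prod (MeasurableSet.univ_pi hB)
  have h1 : P {ω | (U ω ∈ D ∧ ∀ i, S ω i ∈ B i) ∧ μt ω ∈ A} =
      ∫⁻ m, (∏ i, normalizeMeasure m (B i)) * (A.indicator 1 m * G m)
        ∂(tiltedLaw (petTilt γ q) L) := by
    have h2 := hS.augmentation _ D hpi hD
    have h3 : {ω | (U ω ∈ D ∧ ∀ i, S ω i ∈ B i) ∧ μt ω ∈ A} =
        {ω | (μt ω, S ω) ∈ A ×ˢ univ.pi B ∧ U ω ∈ D} := by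
      ext ω
      simp only [mem_ofPred_eq, mem_prod, mem_univ_pi]
      tauto
    have h4 : {ω | (μt ω, S ω) ∈ A ×ˢ univ.pi B} = μt ⁻¹' A ∩ E := by
      ext ω
      simp [hE]
    rw [h3, h2, h4, ← Measure.restrict_restrict (hS.measurable_measure hA),
      ← lintegral_indicator (hS.measurable_measure hA), ← hS.lintegral_likelihood hB hAG]
    refine lintegral_congr fun ω => ?_
    by_cases hω : μt ω ∈ A
    · rw [indicator_of_mem (show ω ∈ μt ⁻¹' A from hω), indicator_of_mem hω]
      simp [G]
    · rw [indicator_of_notMem (show ω ∉ μt ⁻¹' A from hω), indicator_of_notMem hω]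
      simp
  set k : ℝ → ℝ≥0∞ := fun u =>
    (ENNReal.ofReal (Real.Gamma (n + q)))⁻¹ * ENNReal.ofReal (u ^ ((n : ℝ) + q - 1)) with hk
  have hkm : Measurable k := by fun_prop
  have hpt : ∀ᵐ m ∂L, ENNReal.ofReal (petTilt γ q (m univ).toReal) *
      ((∏ i, normalizeMeasure m (B i)) * (A.indicator 1 m * G m)) =
      ∫⁻ u in Ioi 0, D.indicator 1 u * (k u * (expNeg (ENNReal.ofReal (γ + u) * m univ) *
        (A.indicator 1 m * ∏ i, m (B i)))) := by
    filter_upwards [hT] with m hm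
    have hnorm : ∏ i, normalizeMeasure m (B i) = (m univ)⁻¹ ^ n * ∏ i, m (B i) := by
      simp [normalizeMeasure, Finset.prod_mul_distrib]
    simp only [G]
    have hpm : Measurable fun u => D.indicator 1 u * gammaPDF (n + q) (m univ).toReal u :=
      hpdf.comp measurable_prodMk_left
    rw [hnorm, gammaMeasure_apply _ _ hD, ← lintegral_const_mul _ hpm, ← lintegral_const_mul _
      (hpm.const_mul _), ← lintegral_const_mul _ ((hpm.const_mul _).const_mul _)]
    refine setLIntegral_congr_fun measurableSet_Ioi fun u hu => ?_
    have key := petTilt_mul_gammaPDF (q := q) hγ n hn hm.1 hm.2 hu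
    simp only [hk]
    calc _ = D.indicator 1 u * ((ENNReal.ofReal (petTilt γ q (m univ).toReal) *
        ((m univ)⁻¹ ^ n * gammaPDF (n + q) (m univ).toReal u)) *
          (A.indicator 1 m * ∏ i, m (B i))) := by ring
      _ = _ := by rw [key]; ring
  have hjoint : Measurable fun p : Measure X × ℝ => D.indicator 1 p.2 * (k p.2 *
      (expNeg (ENNReal.ofReal (γ + p.2) * p.1 univ) *
        (A.indicator 1 p.1 * ∏ i, p.1 (B i)))) := by
    have h2 : Measurable fun p : Measure X × ℝ => p.1 univ := huniv.comp measurable_fst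
    have h3 : Measurable fun p : Measure X × ℝ =>
      expNeg (ENNReal.ofReal (γ + p.2) * p.1 univ) := by fun_prop
    exact (hDi.comp measurable_snd).mul ((hkm.comp measurable_snd).mul
      (h3.mul (hF.comp measurable_fst)))
  rw [h1, tiltedLaw, lintegral_smul_measure, lintegral_withDensity_mul _
    (measurable_petTilt_univ γ q) hwAG, lintegral_congr_ae hpt,
    lintegral_lintegral_swap hjoint.aemeasurable, smul_eq_mul,
    ← lintegral_const_mul _ hjoint.lintegral_prod_left']
  refine setLIntegral_congr_fun measurableSet_Ioi fun u hu => ?_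
  have ha : 0 < γ + u := add_pos_of_nonneg_of_pos hγ hu
  have hm1 : Measurable fun m : Measure X => expNeg (ENNReal.ofReal (γ + u) * m univ) *
        (A.indicator 1 m * ∏ i, m (B i)) := (measurable_expNeg_mul_univ _).mul hF
  let κ₁ : Kernel (Fin n → X) (Measure X) := κ.comap (fun x => (γ + u, x)) (by fun_prop)
  have hκ₁ : ∀ x, κ₁ x = κ (γ + u, x) := fun x => by rw [Kernel.comap_apply]
  have hmain := lintegral_mul_prod_expTilt hL hρ hfin ha n κ₁ (fun x hx => by
    rw [hκ₁]; exact hκ _ x hx) hAi hB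
  simp only [lintegral_indicator_one hA, hκ₁] at hmain
  have hxm : Measurable fun x : Fin n → X => (∏ i, (B i).indicator (1 : X → ℝ≥0∞) (x i)) *
      (sampleWeight ρ (γ + u) x * κ (γ + u, x) A) :=
    (Finset.measurable_prod _ fun i _ => (measurable_one.indicator (hB i)).comp
      (measurable_pi_apply i)).mul ((measurable_sampleWeight measurable_const measurable_id).mul
      ((Kernel.measurable_coe κ hA).comp measurable_prodMk_left))
  dsimp only
  rw [lintegral_const_mul _ (hm1.const_mul _), lintegral_const_mul _ hm1,
    ← lintegral_expTilt (hfin _) hF, hmain, mul_left_comm]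
  congr 1
  rw [← lintegral_const_mul _ hxm, ← lintegral_const_mul _ (hxm.const_mul _),
    ← lintegral_const_mul _ ((hxm.const_mul _).const_mul _)]
  refine lintegral_congr fun x => ?_
  rw [auxWeight_eq hρ ha.le (hfin _), jointConst]
  simp only [hk]
  ring

theorem IsAugmentedSample.map_eq_compProd [IsProbabilityMeasure P]
    (hS : IsAugmentedSample (tiltedLaw (petTilt γ q) L) q P μt S U)
    (hL : IsCRMLaw L (η ⊗ₘ ρ)) (hρ : ∀ x, ρ x (Iic 0) = 0)
    (hfin : ∀ a : ℝ, crmExponent (η ⊗ₘ ρ) (fun _ => ENNReal.ofReal a) ≠ ∞)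
    (hT : ∀ᵐ m ∂L, 0 < m univ ∧ m univ < ∞) (hγ : 0 ≤ γ) (hn : 0 < (n : ℝ) + q)
    (κ : Kernel (ℝ × (Fin n → X)) (Measure X)) [IsFiniteKernel κ]
    (hκ : ∀ a x, IsRegular ρ a x → κ (a, x) = posteriorLaw L (η ⊗ₘ ρ) ρ a x) :
    P.map (fun ω => ((U ω, S ω), μt ω)) = auxLaw η ρ L γ q n ⊗ₘ
      κ.comap (fun p => (γ + p.1, p.2)) (by fun_prop) := by
  have hmeas : Measurable fun ω => ((U ω, S ω), μt ω) :=
    (hS.measurable_aux.prodMk hS.measurable_data).prodMk hS.measurable_measure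
  have := Measure.isProbabilityMeasure_map (μ := P) hmeas.aemeasurable
  refine Measure.ext_prod₃' fun {D T A} hD hTm hA => ?_
  have hDi : Measurable (D.indicator (1 : ℝ → ℝ≥0∞)) := measurable_one.indicator hD
  have hκA : Measurable fun p : ℝ × (Fin n → X) => κ (γ + p.1, p.2) A :=
    (Kernel.measurable_coe κ hA).comp (by fun_prop)
  have hW : Measurable fun p : ℝ × (Fin n → X) =>
      jointConst L γ q n * auxWeight η ρ γ q p.2 p.1 * κ (γ + p.1, p.2) A :=
    ((measurable_auxWeight γ q n).const_mul _).mul hκA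
  have hH : Measurable fun p : ℝ × (Fin n → X) => D.indicator 1 p.1 *
      (jointConst L γ q n * auxWeight η ρ γ q p.2 p.1 * κ (γ + p.1, p.2) A) :=
    (hDi.comp measurable_fst).mul hW
  have hmap : ∀ T', MeasurableSet T' → P.map (fun ω => ((U ω, S ω), μt ω)) ((D ×ˢ T') ×ˢ A) =
      (P.restrict (U ⁻¹' D ∩ μt ⁻¹' A)).map S T' := by
    intro T' hT'
    rw [Measure.map_apply hS.measurable_data hT', Measure.restrict_apply (hS.measurable_data hT'),
      Measure.map_apply hmeas ((hD.prod hT').prod hA)]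
    congr 1
    ext ω
    simp only [mem_inter_iff, mem_preimage, mem_prod]
    tauto
  rw [hmap T hTm, eq_lintegral_of_box (V := volume.restrict (Ioi 0)) (Λ := sampleMeasure η n)
    hH ?_ hTm]
  · rw [Measure.compProd_apply_prod (hD.prod hTm) hA, ← lintegral_indicator (hD.prod hTm)]
    simp only [Kernel.comap_apply]
    rw [lintegral_auxLaw (hκA.indicator (hD.prod hTm))]
    refine lintegral_congr fun u => lintegral_congr fun x => ?_
    by_cases hu : u ∈ D <;> by_cases hx : x ∈ T <;> simp [hu, hx]
  · intro B hB
    have hBm := MeasurableSet.univ_pi hB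
    have h1 := hS.measure_box hL hρ hfin hT hγ hn κ hκ hA hB hD
    have h2 : P {ω | (U ω ∈ D ∧ ∀ i, S ω i ∈ B i) ∧ μt ω ∈ A} =
        (P.restrict (U ⁻¹' D ∩ μt ⁻¹' A)).map S (univ.pi B) := by
      rw [← hmap _ hBm, Measure.map_apply hmeas ((hD.prod hBm).prod hA)]
      congr 1
      ext ω
      simp
    rw [← h2, h1]
    refine lintegral_congr fun u => ?_
    have hBi : Measurable fun x : Fin n → X => ∏ i, (B i).indicator (1 : X → ℝ≥0∞) (x i) :=
      Finset.measurable_prod _ fun i _ => (measurable_one.indicator (hB i)).comp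
        (measurable_pi_apply i)
    have hWu : Measurable fun x : Fin n → X =>
        jointConst L γ q n * auxWeight η ρ γ q x u * κ (γ + u, x) A := by
      have h := hW.comp (measurable_prodMk_left (x := u) (β := Fin n → X))
      exact h
    have h3 : Measurable fun x : Fin n → X => (∏ i, (B i).indicator (1 : X → ℝ≥0∞) (x i)) *
        (jointConst L γ q n * auxWeight η ρ γ q x u * κ (γ + u, x) A) :=
      hBi.mul hWu
    rw [← lintegral_const_mul _ h3]
    exact lintegral_congr fun x => by ring

end JointLaw

section CompletelyRandom

/-- A function that preserves the neutral element is additive on sums with at most one nonzero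
term. -/
@[to_additive]
lemma map_sum_eq_prod_of_eq_zero_or {ι M : Type*} [Fintype ι] [CommMonoid M] {c : ι → ℝ≥0∞}
    (hc : ∀ i j, i ≠ j → c i = 0 ∨ c j = 0) {φ : ℝ≥0∞ → M} (hφ : φ 0 = 1) :
    φ (∑ i, c i) = ∏ i, φ (c i) := by
  classical
  by_cases h : ∀ i, c i = 0
  · simp [h, hφ]
  · push Not at h
    obtain ⟨i, hi⟩ := h
    have h0 : ∀ j, j ≠ i → c j = 0 := fun j hj => (hc j i hj).resolve_right hi
    rw [Finset.sum_eq_single i (fun j _ hj => h0 j hj) (by simp),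
      Finset.prod_eq_single i (fun j _ hj => by rw [h0 j hj, hφ]) (by simp)]

variable {X ι κ : Type*} [MeasurableSpace X] [Fintype ι] [Fintype κ]

lemma iIndepFun_apply_map_addAtoms {L : Measure (Measure X)} {ν : Measure (X × ℝ)} [SigmaFinite ν]
    (hL : IsCRMLaw L ν) {J : ι → Measure ℝ} [∀ i, IsProbabilityMeasure (J i)] (y : ι → X)
    {A : κ → Set X} (hA : ∀ i, MeasurableSet (A i))
    (hd : Pairwise fun i j => Disjoint (A i) (A j)) :
    iIndepFun (fun i (m : Measure X) => m (A i)) ((L.prod (Measure.pi J)).map (addAtoms y)) := by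
  have := hL.isProbabilityMeasure
  refine iIndepFun_of_expNeg (fun i => Measure.measurable_coe (hA i)) fun k => ?_
  let f : κ → X → ℝ≥0∞ := fun i x => k i * (A i).indicator 1 x
  have hf : ∀ i, Measurable (f i) := fun i =>
    (measurable_one.indicator (hA i)).const_mul _
  have hfs : Measurable fun x => ∑ i, f i x := Finset.measurable_sum _ fun i _ => hf i
  have hfm : ∀ i (m : Measure X), k i * m (A i) = ∫⁻ x, f i x ∂m := fun i m => by
    simp only [f]
    rw [lintegral_const_mul _ (measurable_one.indicator (hA i)), lintegral_indicator_one (hA i)]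
  have hzero : ∀ x (s : ℝ≥0∞) i j, i ≠ j → f i x * s = 0 ∨ f j x * s = 0 := by
    intro x s i j hij
    by_cases hi : x ∈ A i
    · right
      simp [f, indicator_of_notMem (disjoint_left.1 (hd hij) hi)]
    · left
      simp [f, indicator_of_notMem hi]
  have hs : ∀ m : Measure X, ∑ i, k i * m (A i) = ∫⁻ x, ∑ i, f i x ∂m := fun m => by
    rw [lintegral_finsetSum _ fun i _ => hf i]
    simp only [hfm]
  simp only [hs]
  simp only [hfm, laplace_map_addAtoms y (hf _), laplace_map_addAtoms y hfs, hL.laplace (hf _),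
    hL.laplace hfs]
  rw [Finset.prod_mul_distrib, ← expNeg_sum, Finset.prod_comm]
  congr 1
  · simp only [crmExponent]
    rw [← lintegral_finsetSum _ fun i _ => by have := hf i; fun_prop]
    congr 1
    refine lintegral_congr fun p => ?_
    rw [Finset.sum_mul]
    exact map_sum_eq_sum_of_eq_zero_or (hzero p.1 _) (φ := fun c => 1 - expNeg c) (by simp)
  · refine Finset.prod_congr rfl fun j _ => ?_
    have h1 := map_sum_eq_prod_of_eq_zero_or (c := fun i => f i (y j)) (fun i i' h => by
      simpa using hzero (y j) 1 i i' h)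
      (φ := fun c => ∫⁻ s, expNeg (c * ENNReal.ofReal s) ∂(J j)) (by simp)
    exact h1

end CompletelyRandom

section CondLaw

variable {Ω Y : Type*} [MeasurableSpace Ω] [MeasurableSpace Y] {P : Measure Ω}
  [IsProbabilityMeasure P] {U : Ω → ℝ} {S : Ω → Y}

/-- The conditional law of `U` given `S` when `(U, S)` has a density. -/
lemma exists_condDistrib_of_density (hU : Measurable U) (hS : Measurable S) {V : Measure ℝ}
    [SFinite V] {Λ : Measure Y} [SFinite Λ] {w : ℝ × Y → ℝ≥0∞} (hw : Measurable w)
    {c : ℝ≥0∞} (hc : c ≠ 0)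
    (h : P.map (fun ω => (U ω, S ω)) = (V.prod Λ).withDensity fun p => c * w p) :
    ∃ κ : Kernel Y ℝ, IsMarkovKernel κ ∧ HasCondDistrib U S κ P ∧
      ∀ᵐ x ∂(P.map S), 0 < ∫⁻ u, w (u, x) ∂V ∧ ∫⁻ u, w (u, x) ∂V < ∞ ∧
        κ x = V.withDensity fun u => w (u, x) / ∫⁻ v, w (v, x) ∂V := by
  have hUS := hU.prodMk hS
  have hSU := hS.prodMk hU
  let I : Set ℝ → Y → ℝ≥0∞ := fun D x => ∫⁻ u in D, w (u, x) ∂V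
  have hI : ∀ D, Measurable (I D) := fun D => hw.lintegral_prod_left'
  let Z : Y → ℝ≥0∞ := fun x => ∫⁻ u, w (u, x) ∂V
  have hZ : Measurable Z := hw.lintegral_prod_left'
  have hZI : Z = I univ := by simp [Z, I]
  have hjoint : ∀ B D, MeasurableSet B → MeasurableSet D →
      P.map (fun ω => (S ω, U ω)) (B ×ˢ D) = ∫⁻ x in B, c * I D x ∂Λ := by
    intro B D hB hD
    have h1 : P.map (fun ω => (S ω, U ω)) (B ×ˢ D) = P.map (fun ω => (U ω, S ω)) (D ×ˢ B) := by
      rw [Measure.map_apply hSU (hB.prod hD), Measure.map_apply hUS (hD.prod hB)]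
      congr 1
      ext ω
      simp [and_comm]
    rw [h1, h, withDensity_apply _ (hD.prod hB), ← Measure.prod_restrict,
      lintegral_prod_symm' _ (hw.const_mul _)]
    refine lintegral_congr fun x => ?_
    have hc' : Measurable fun u => w (u, x) := hw.comp measurable_prodMk_right
    rw [lintegral_const_mul _ hc']
  have hmS : P.map S = Λ.withDensity fun x => c * Z x := by
    ext B hB
    rw [withDensity_apply _ hB, hZI, ← hjoint B univ hB MeasurableSet.univ,
      Measure.map_apply hS hB, Measure.map_apply hSU (hB.prod MeasurableSet.univ)]
    congr 1
    ext ω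
    simp
  have hcZ : Measurable fun x => c * Z x := hZ.const_mul _
  have hZtop : ∀ᵐ x ∂Λ, Z x < ∞ := by
    have h1 : ∫⁻ x, c * Z x ∂Λ ≠ ∞ := by
      have := Measure.isProbabilityMeasure_map (μ := P) hS.aemeasurable
      have h2 := measure_univ (μ := P.map S)
      rw [hmS, withDensity_apply _ MeasurableSet.univ, Measure.restrict_univ] at h2
      rw [h2]
      exact ENNReal.one_ne_top
    filter_upwards [ae_lt_top hcZ h1] with x hx
    exact lt_top_iff_ne_top.2 fun h => by simp [h, hc] at hx
  have hgood : ∀ᵐ x ∂(P.map S), 0 < Z x ∧ Z x < ∞ := by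
    rw [hmS, ae_withDensity_iff hcZ]
    filter_upwards [hZtop] with x hx h0
    exact ⟨pos_iff_ne_zero.2 fun h => h0 (by rw [h, mul_zero]), hx⟩
  have hG : MeasurableSet {x | 0 < Z x ∧ Z x < ∞} :=
    (measurableSet_lt measurable_const hZ).inter (measurableSet_lt hZ measurable_const)
  have hd : Measurable (Function.uncurry fun (x : Y) (u : ℝ) => w (u, x) / Z x) :=
    (hw.comp measurable_swap).div (hZ.comp measurable_fst)
  classical
  let κ : Kernel Y ℝ := Kernel.piecewise hG
    (Kernel.withDensity (Kernel.const Y V) fun x u => w (u, x) / Z x)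
    (Kernel.const Y (Measure.dirac 0))
  have hκ : ∀ x, 0 < Z x ∧ Z x < ∞ → κ x = V.withDensity fun u => w (u, x) / Z x := by
    intro x hx
    rw [Kernel.piecewise_apply, if_pos (show x ∈ {x | 0 < Z x ∧ Z x < ∞} from hx),
      Kernel.withDensity_apply _ hd, Kernel.const_apply]
  have hκD : ∀ x D, MeasurableSet D → 0 < Z x ∧ Z x < ∞ → Z x * κ x D = I D x := by
    intro x D hD hx
    have hc' : Measurable fun u => w (u, x) := hw.comp measurable_prodMk_right
    rw [hκ x hx, withDensity_apply _ hD]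
    simp only [div_eq_mul_inv]
    rw [lintegral_mul_const _ hc', mul_comm, mul_assoc, ENNReal.inv_mul_cancel hx.1.ne' hx.2.ne,
      mul_one]
  have hmarkov : IsMarkovKernel κ := by
    refine ⟨fun x => ?_⟩
    by_cases hx : 0 < Z x ∧ Z x < ∞
    · constructor
      have h1 := hκD x univ MeasurableSet.univ hx
      rw [← hZI] at h1
      exact (ENNReal.mul_eq_left hx.1.ne' hx.2.ne).1 h1
    · rw [Kernel.piecewise_apply, if_neg (show x ∉ {x | 0 < Z x ∧ Z x < ∞} from hx),
        Kernel.const_apply]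
      infer_instance
  refine ⟨κ, hmarkov, ⟨hSU.aemeasurable, ?_⟩, hgood.mono fun x hx => ⟨hx.1, hx.2, hκ x hx⟩⟩
  have := Measure.isProbabilityMeasure_map (μ := P) hS.aemeasurable
  have := Measure.isProbabilityMeasure_map (μ := P) hSU.aemeasurable
  refine Measure.ext_prod fun {B D} hB hD => ?_
  rw [hjoint B D hB hD, Measure.compProd_apply_prod hB hD]
  have hκm : Measurable fun x => κ x D := Kernel.measurable_coe κ hD
  rw [← lintegral_indicator hB, ← lintegral_indicator hB, hmS,
    lintegral_withDensity_mul _ hcZ (hκm.indicator hB)]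
  refine lintegral_congr_ae ?_
  filter_upwards [hZtop] with x hx
  by_cases hB : x ∈ B
  · simp only [indicator_of_mem hB]
    rcases eq_or_ne (Z x) 0 with h0 | h0
    · have : I D x = 0 := le_antisymm (h0 ▸ setLIntegral_le_lintegral D _) bot_le
      rw [h0, this]
      simp
    · rw [mul_assoc, hκD x D hD ⟨pos_iff_ne_zero.2 h0, hx⟩]
  · simp [indicator_of_notMem hB]

end CondLaw

section Regular

variable {X : Type*} [MeasurableSpace X] {η : Measure X} [IsProbabilityMeasure η]
  {ρ : Kernel X ℝ} [IsSFiniteKernel ρ] {L : Measure (Measure X)} {γ q : ℝ} {n : ℕ}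

lemma isPosteriorCRMLaw_posteriorLaw [SigmaFinite (η ⊗ₘ ρ)] (hL : IsCRMLaw L (η ⊗ₘ ρ))
    (hρ : ∀ x, ρ x (Iic 0) = 0) {a : ℝ} (ha : 0 ≤ a)
    (hfin : crmExponent (η ⊗ₘ ρ) (fun _ => ENNReal.ofReal a) ≠ ∞) (x : Fin n → X) :
    IsPosteriorCRMLaw η ρ a x (posteriorLaw L (η ⊗ₘ ρ) ρ a x) :=
  ⟨expTilt L (η ⊗ₘ ρ) (ENNReal.ofReal a), by
    rw [expIntensity_eq hρ ha]
    exact hL.expTilt hfin, rfl⟩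

/-- If the total mass is finite, the posterior law is that of a completely random measure. -/
lemma isCompletelyRandom_posteriorLaw {X : Type*} [MeasurableSpace X] [PseudoMetricSpace X]
    {ν : Measure (X × ℝ)} [SigmaFinite ν] {L : Measure (Measure X)} (hL : IsCRMLaw L ν)
    {ρ : Kernel X ℝ} {a : ℝ} (hfin : crmExponent ν (fun _ => ENNReal.ofReal a) ≠ ∞)
    {x : Fin n → X} (hx : IsRegular ρ a x)
    (h : ∀ᵐ m ∂(posteriorLaw L ν ρ a x), m univ < ∞) :
    IsCompletelyRandom (posteriorLaw L ν ρ a x) := by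
  have hLa := hL.expTilt hfin
  have := hLa.isProbabilityMeasure
  have : ∀ y : distinctValues x, IsProbabilityMeasure (jumpLaw ρ (clusterSize x y.1) y.1 a) :=
    fun y => isProbabilityMeasure_jumpLaw (hx y.1 y.2).1 (hx y.1 y.2).2
  refine ⟨isProbabilityMeasure_map_addAtoms _, ?_, fun k A hA _ hd =>
    iIndepFun_apply_map_addAtoms hLa _ hA hd⟩
  filter_upwards [h] with m hm A _ _ using (measure_mono (subset_univ A)).trans_lt hm

/-- Almost every value of the auxiliary variable and of the data is regular. -/
lemma ae_auxLaw_isRegular [MeasurableEq X] (hρ : ∀ x, ρ x (Iic 0) = 0)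
    (hfin : ∀ a : ℝ, crmExponent (η ⊗ₘ ρ) (fun _ => ENNReal.ofReal a) ≠ ∞) (hγ : 0 ≤ γ) :
    ∀ᵐ z ∂(auxLaw η ρ L γ q n), 0 < z.1 ∧ IsRegular ρ (γ + z.1) z.2 := by
  have hw : Measurable fun p : ℝ × (Fin n → X) =>
      jointConst L γ q n * auxWeight η ρ γ q p.2 p.1 := (measurable_auxWeight γ q n).const_mul _
  have h1 : ∀ᵐ z ∂((volume.restrict (Ioi (0 : ℝ))).prod (sampleMeasure η n)), 0 < z.1 :=
    Measure.quasiMeasurePreserving_fst.ae (ae_restrict_mem measurableSet_Ioi)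
  have h2 : ∀ᵐ z ∂((volume.restrict (Ioi (0 : ℝ))).prod (sampleMeasure η n)),
      ∀ i, z.2 i ∈ finiteFibre ρ :=
    Measure.quasiMeasurePreserving_snd.ae (ae_sampleMeasure η measurableSet_finiteFibre
      (ae_mem_finiteFibre (by simpa using hfin 1)) n)
  rw [auxLaw, ae_withDensity_iff hw]
  filter_upwards [h1, h2] with z hz1 hz2 hne
  refine ⟨hz1, fun y hy => ?_⟩
  have ha : 0 < γ + z.1 := by linarith
  refine ⟨pos_iff_ne_zero.2 fun h0 => hne ?_, tau_lt_top_of_mem hρ ha hz2 hy⟩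
  rw [auxWeight, Finset.prod_eq_zero hy h0]
  simp

end Regular

lemma jointConst_ne_zero {X : Type*} [MeasurableSpace X] {L : Measure (Measure X)} {γ q : ℝ}
    (h : tiltConst (petTilt γ q) L ≠ ∞) (n : ℕ) : jointConst L γ q n ≠ 0 :=
  mul_ne_zero (ENNReal.inv_ne_zero.2 h) (ENNReal.inv_ne_zero.2 ENNReal.ofReal_ne_top)

end

end TiltedCRM

theorem theorem3p2
    {X : Type*} [MetricSpace X] [PolishSpace X] [MeasurableSpace X] [BorelSpace X]
    -- the intensity `ν(dx, ds) = η(dx) ρ_x(ds)` on `X × (0, ∞)`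
    (η : Measure X) [IsProbabilityMeasure η] [NullSingletonClass η]
    (ρ : Kernel X ℝ) [IsSFiniteKernel ρ] (hρ : ∀ x, ρ x (Iic 0) = 0)
    (hν : ∀ A : Set X, MeasurableSet A → Bornology.IsBounded A → ∀ t : ℝ, 0 < t →
      ∫⁻ p in A ×ˢ univ, ENNReal.ofReal (min p.2 t) ∂(η ⊗ₘ ρ) < ∞)
    -- the law `L` of the completely random measure with intensity `ν`
    (L : Measure (Measure X)) (hL : TiltedCRM.IsCRMLaw L (η ⊗ₘ ρ))
    (hT : ∀ᵐ m ∂L, 0 < m univ ∧ m univ < ∞)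
    -- the tilt `h(x) = e^{-γ x} x^{-q}`
    (γ q : ℝ) (hγ : 0 ≤ γ) (hq : 0 ≤ q)
    (hh : TiltedCRM.tiltConst (TiltedCRM.petTilt γ q) L < ∞)
    -- the tilted random measure, the data and the augmentation variable
    {Ω : Type*} [MeasurableSpace Ω] (P : Measure Ω) [IsProbabilityMeasure P]
    (n : ℕ) (hn : 1 ≤ n) (μt : Ω → Measure X) (S : Ω → Fin n → X) (U : Ω → ℝ)
    (hS : TiltedCRM.IsAugmentedSample
      (TiltedCRM.tiltedLaw (TiltedCRM.petTilt γ q) L) q P μt S U) :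
    -- the conditional laws given `(U, S)`
    (∃ κ : Kernel (ℝ × (Fin n → X)) (Measure X), IsMarkovKernel κ ∧
      HasCondDistrib μt (fun ω => (U ω, S ω)) κ P ∧
      HasCondDistrib (fun ω => TiltedCRM.normalizeMeasure (μt ω)) (fun ω => (U ω, S ω))
        (κ.map TiltedCRM.normalizeMeasure) P ∧
      ∀ᵐ z ∂(P.map (fun ω => (U ω, S ω))),
        0 < z.1 ∧
        (∀ y ∈ TiltedCRM.distinctValues z.2,
          0 < TiltedCRM.tau ρ (TiltedCRM.clusterSize z.2 y) y (γ + z.1) ∧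
          TiltedCRM.tau ρ (TiltedCRM.clusterSize z.2 y) y (γ + z.1) < ∞) ∧
        TiltedCRM.IsPosteriorCRMLaw η ρ (γ + z.1) z.2 (κ z) ∧
        TiltedCRM.IsCompletelyRandom (κ z) ∧
        ∀ᵐ m ∂(κ z), 0 < m univ ∧ m univ < ∞) ∧
    -- the conditional law of `U` given `S`
    (∀ b : ℝ, 0 < b → TiltedCRM.psi η ρ 0 b < ∞) ∧
    (∃ κ : Kernel (Fin n → X) ℝ, IsMarkovKernel κ ∧ HasCondDistrib U S κ P ∧
      ∀ᵐ x ∂(P.map S),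
        0 < ∫⁻ u in Ioi (0 : ℝ), TiltedCRM.auxWeight η ρ γ q x u ∧
        ∫⁻ u in Ioi (0 : ℝ), TiltedCRM.auxWeight η ρ γ q x u < ∞ ∧
        κ x = (volume.restrict (Ioi (0 : ℝ))).withDensity
          (TiltedCRM.auxDensity η ρ γ q x)) := by
  have := TiltedCRM.sigmaFinite_intensity hρ hν
  have hfin : ∀ a : ℝ, TiltedCRM.crmExponent (η ⊗ₘ ρ) (fun _ => ENNReal.ofReal a) ≠ ∞ :=
    fun a => TiltedCRM.crmExponent_ne_top_of_ae_lt_top hL (hT.mono fun m hm => hm.2)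
      ENNReal.ofReal_ne_top
  have hnq : 0 < (n : ℝ) + q := by
    have : (1 : ℝ) ≤ n := by exact_mod_cast hn
    linarith
  obtain ⟨κ₀, _, hκ₀⟩ := TiltedCRM.exists_posteriorKernel hL hfin ρ n
  let κ : Kernel (ℝ × (Fin n → X)) (Measure X) :=
    κ₀.comap (fun p => (γ + p.1, p.2)) (by fun_prop)
  have hκ : ∀ z, κ z = κ₀ (γ + z.1, z.2) := fun z => by rw [Kernel.comap_apply]
  have hUS := hS.measurable_aux.prodMk hS.measurable_data
  have hUSμ := hUS.prodMk hS.measurable_measure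
  have hjoint : P.map (fun ω => ((U ω, S ω), μt ω)) = TiltedCRM.auxLaw η ρ L γ q n ⊗ₘ κ :=
    hS.map_eq_compProd hL hρ hfin hT hγ hnq κ₀ hκ₀
  have hmarg : P.map (fun ω => (U ω, S ω)) = TiltedCRM.auxLaw η ρ L γ q n := by
    have h1 := congrArg Measure.fst hjoint
    rwa [Measure.fst_compProd, Measure.fst_map_prodMk hS.measurable_measure] at h1
  have hcond : HasCondDistrib μt (fun ω => (U ω, S ω)) κ P :=
    ⟨hUSμ.aemeasurable, by rw [hmarg, hjoint]⟩
  have hmass : ∀ᵐ z ∂(TiltedCRM.auxLaw η ρ L γ q n), ∀ᵐ m ∂(κ z), 0 < m univ ∧ m univ < ∞ := by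
    refine Measure.ae_ae_of_ae_compProd (p := fun p : (ℝ × (Fin n → X)) × Measure X => 0 < p.2 univ ∧ p.2 univ < ∞) ?_
    have hms : MeasurableSet {m : Measure X | 0 < m univ ∧ m univ < ∞} :=
      (measurableSet_lt measurable_const (Measure.measurable_coe MeasurableSet.univ)).inter
        (measurableSet_lt (Measure.measurable_coe MeasurableSet.univ) measurable_const)
    have h1 : ∀ᵐ m ∂(P.map μt), 0 < m univ ∧ m univ < ∞ := by
      rw [hS.prior, TiltedCRM.tiltedLaw]
      exact Measure.ae_smul_measure ((withDensity_absolutelyContinuous _ _).ae_le hT) _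
    rw [← hjoint]
    refine (ae_map_iff hUSμ.aemeasurable (measurable_snd hms)).2 ?_
    exact ae_of_ae_map hS.measurable_measure.aemeasurable h1
  refine ⟨⟨κ, inferInstance, hcond, hcond.comp_left TiltedCRM.measurable_normalizeMeasure, ?_⟩,
    fun b hb => ?_, ?_⟩
  · rw [hmarg]
    filter_upwards [TiltedCRM.ae_auxLaw_isRegular hρ hfin hγ, hmass] with z hz hm
    have heq : κ z = TiltedCRM.posteriorLaw L (η ⊗ₘ ρ) ρ (γ + z.1) z.2 := by
      rw [hκ, hκ₀ _ _ hz.2]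
    refine ⟨hz.1, hz.2, ?_, ?_, hm⟩
    · rw [heq]
      exact TiltedCRM.isPosteriorCRMLaw_posteriorLaw hL hρ (by linarith [hz.1]) (hfin _) _
    · rw [heq] at hm ⊢
      exact TiltedCRM.isCompletelyRandom_posteriorLaw hL (hfin _) hz.2 (hm.mono fun m h => h.2)
  · rw [TiltedCRM.psi_zero_eq_crmExponent hρ hb.le]
    exact (hfin b).lt_top
  · exact TiltedCRM.exists_condDistrib_of_density hS.measurable_aux hS.measurable_data
      (TiltedCRM.measurable_auxWeight γ q n) (TiltedCRM.jointConst_ne_zero hh.ne n) hmarg
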